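/- Let $r\in(0,1)$ and let $G$ be a finite directed multigraph with vertex set $\{1,\dots,p\}$; let $\mathcal E_{i,j}$ be the set of edges from $i$ to $j$, and let $A=(\#\mathcal E_{i,j})_{1\le i,j\le p}$ be its adjacency matrix. Let $(X,d)$ be a compact metric space and, for each edge $e$, let $S_e:X\to X$ be a similitude of ratio $r$, i.e. $d(S_e x,S_e y)=r\,d(x,y)$ for all $x,y\in X$. Let $K_1,\dots,K_p\subset X$ be nonempty compact sets with $$K_i=\bigcup_{j}\bigcup_{e\in\mathcal E_{i,j}}S_e(K_j)\qquad(1\le i\le p),$$ and suppose that $\{K_i\}_{i=1}^p$ is dust-like, i.e. for every $i$ the sets $S_e(K_j)$ ($1\le j\le p$, $e\in\mathcal E_{i,j}$) in this union are pairwise disjoint. Suppose further that it has integer characteristic $m$, i.e. $m\ge 2$ is an integer and there is a vector $v\in\mathbb R^p$ with all entries positive such that $Av=mv$. Let $\Sigma_m^r=\{1,\dots,m\}^\infty$ be the set of infinite words $x_0x_1x_2\cdots$ over $m$ letters, with the metric $d(x,y)=r^{\min\{k\,:\,x_k\ne y_k\}}$ for $x\neq y$ and $d(x,x)=0$. Then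 every $K_i$, $1\le i\le p$, is bilipschitz equivalent to $\Sigma_m^r$: there are a bijection $f:K_i\to\Sigma_m^r$ and a constant $C>0$ such that $C^{-1}d(x,y)\le d(f(x),f(y))\le C\,d(x,y)$ for all $x,y\in K_i$. -/

import Mathlib

/-- The set `{1, …, m}^∞` of infinite words over an alphabet with `m` letters. The ratio
`r ∈ (0, 1)` is recorded in the type because the metric depends on it. -/
def SymbolicSpace (m : ℕ) (_r : Set.Ioo (0 : ℝ) 1) : Type := ℕ → Fin m

namespace SymbolicSpace

variable {m : ℕ} {r : Set.Ioo (0 : ℝ) 1}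

open Classical in
/-- `d(x, y) = r ^ min {k | x k ≠ y k}` for `x ≠ y`, and `d(x, x) = 0`. -/
noncomputable def symbolicDist (x y : SymbolicSpace m r) : ℝ :=
  if x = y then 0 else (r : ℝ) ^ PiNat.firstDiff (E := fun _ => Fin m) x y

theorem symbolicDist_self (x : SymbolicSpace m r) : symbolicDist x x = 0 := by
  simp [symbolicDist]

theorem symbolicDist_comm (x y : SymbolicSpace m r) : symbolicDist x y = symbolicDist y x := by
  by_cases h : x = y
  · rw [h]
  · simp only [symbolicDist, h, Ne.symm h, if_false,
      PiNat.firstDiff_comm (E := fun _ => Fin m) x y]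

theorem symbolicDist_nonneg (x y : SymbolicSpace m r) : 0 ≤ symbolicDist x y := by
  unfold symbolicDist
  split_ifs
  · exact le_rfl
  · exact pow_nonneg r.2.1.le _

theorem symbolicDist_triangle (x y z : SymbolicSpace m r) :
    symbolicDist x z ≤ symbolicDist x y + symbolicDist y z := by
  by_cases hxz : x = z
  · subst hxz
    rw [symbolicDist_self]
    exact add_nonneg (symbolicDist_nonneg _ _) (symbolicDist_nonneg _ _)
  by_cases hxy : x = y
  · subst hxy
    simp [symbolicDist_self]
  by_cases hyz : y = z
  · subst hyz
    simp [symbolicDist_self]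
  have h := PiNat.min_firstDiff_le (E := fun _ => Fin m) x y z hxz
  have h1 := symbolicDist_nonneg x y
  have h2 := symbolicDist_nonneg y z
  simp only [symbolicDist, hxz, hxy, hyz, if_false] at h1 h2 ⊢
  rcases min_le_iff.mp h with h | h
  · have := pow_le_pow_of_le_one r.2.1.le r.2.2.le h
    linarith
  · have := pow_le_pow_of_le_one r.2.1.le r.2.2.le h
    linarith

theorem eq_of_symbolicDist_eq_zero {x y : SymbolicSpace m r} (h : symbolicDist x y = 0) :
    x = y := by
  by_contra hxy
  simp only [symbolicDist, hxy, if_false] at h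
  exact (pow_pos r.2.1 _).ne' h

noncomputable instance instMetricSpace : MetricSpace (SymbolicSpace m r) where
  dist := symbolicDist
  dist_self := symbolicDist_self
  dist_comm := symbolicDist_comm
  dist_triangle := symbolicDist_triangle
  eq_of_dist_eq_zero := eq_of_symbolicDist_eq_zero

end SymbolicSpace

/-- Two metric spaces are bilipschitz equivalent: there is a bijection `f` and a constant `C > 0`
with `C⁻¹ d(x, y) ≤ d(f x, f y) ≤ C d(x, y)` for all `x, y`. -/
def BilipschitzEquivalent (B B' : Type*) [MetricSpace B] [MetricSpace B'] : Prop :=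
  ∃ f : B ≃ B', ∃ C : ℝ, 0 < C ∧
    ∀ x y : B, C⁻¹ * dist x y ≤ dist (f x) (f y) ∧ dist (f x) (f y) ≤ C * dist x y

/-- A directed multigraph with vertices `V` and edges `E`, together with a similitude
`S e : X → X` of ratio `r` for each edge `e`. -/
structure GraphDirectedSystem (V E X : Type*) [MetricSpace X] (r : ℝ) where
  /-- the initial vertex of an edge -/
  src : E → V
  /-- the final vertex of an edge -/
  tgt : E → V
  /-- the similitude attached to an edge -/
  S : E → X → X
  dist_S : ∀ e x y, dist (S e x) (S e y) = r * dist x y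

namespace GraphDirectedSystem

variable {V E X : Type*} [MetricSpace X] {r : ℝ}

/-- The adjacency matrix: the entry `(i, j)` is the number of edges from `i` to `j`. -/
noncomputable def adjMatrix (G : GraphDirectedSystem V E X r) : Matrix V V ℕ :=
  Matrix.of fun i j => Nat.card {e : E // G.src e = i ∧ G.tgt e = j}

/-- `K` is the family of graph-directed sets of `G`: nonempty compact sets with
`K i = ⋃ S e (K j)`, the union being over all `j` and all edges `e` from `i` to `j`. -/
structure IsGraphDirectedSets (G : GraphDirectedSystem V E X r) (K : V → Set X) : Prop where
  isCompact : ∀ i, IsCompact (K i)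
  nonempty : ∀ i, (K i).Nonempty
  eq_iUnion : ∀ i, K i = ⋃ e ∈ {e : E | G.src e = i}, G.S e '' K (G.tgt e)

/-- The unions `⋃ S e (K j)` over the edges `e` starting at `i` are disjoint unions. -/
def IsDustLike (G : GraphDirectedSystem V E X r) (K : V → Set X) : Prop :=
  ∀ i, {e : E | G.src e = i}.PairwiseDisjoint fun e => G.S e '' K (G.tgt e)

/-- The system has integer characteristic `m ≥ 2`: its adjacency matrix `A` satisfies
`A v = m v` for some vector `v` with positive real entries. -/
def HasIntegerCharacteristic [Fintype V] (G : GraphDirectedSystem V E X r) (m : ℕ) : Prop :=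
  2 ≤ m ∧ ∃ v : V → ℝ, (∀ i, 0 < v i) ∧
    Matrix.mulVec (G.adjMatrix.map (fun a : ℕ => (a : ℝ))) v = (m : ℝ) • v

end GraphDirectedSystem

/-! Give each copy of $K_j$ the weight $v_j$. Since $Av=mv$, one step of the graph cuts a cell into
separated cells, smaller by the factor $r$, of total weight $m$ times its own. If all weights were
equal, every cell would split into exactly $m$ cells, and coding points by words would be
bilipschitz. In general the subcells have to be regrouped until the counts agree.

The target of the regrouping is `TreeLike`: a set that splits again and again into exactly $M$
separated pieces, with one constant for all scales. Such sets are bilipschitz to $\Sigma_M^\rho$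
(`TreeLike.bilipschitzEquivalent`), and the notion is flexible: finite separated unions of tree-like
sets of one scale are tree-like (`TreeLike.union`), and a tree-like set can be cut into any number
$h\le M$ of tree-like parts.

The weights may be taken to be positive integers (`Matrix.exists_nat_eigenvector`). In a high power
$A^L$ every type leads to a closed class $T$ of types, within which every type occurs often. A
Bézout correction then sorts the subcells of a cell with type in $T$ into groups of exactly equal
weight $W$ (`exists_equal_weight_partition`). A group of weight $W$ therefore splits into exactly
$M=m^L$ groups of weight $W$, so groups, and with them cells of these types, are tree-like. Any
other cell has fewer than $M$ subcells outside the classes; the union of the remaining subcells is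
tree-like and is cut into as many parts as are missing from $M$ (`Expands.treeLike`). Reading words
in blocks of $L$ letters identifies $\Sigma_{m^L}^{r^L}$ with $\Sigma_m^r$. -/

/-! ### Sets split by regular trees. -/

section TreeLike

variable {X : Type*} [MetricSpace X]

/-- `U` has size at most `C * s` and is the union of `M` pieces, pairwise at distance at least
`s / C`, which satisfy `𝒰` at scale `ρ * s`. -/
structure Splits (𝒰 : ℝ → Set X → Prop) (M : ℕ) (ρ C s : ℝ) (U : Set X) : Prop where
  pos : 0 < s
  nonempty : U.Nonempty
  isCompact : IsCompact U
  dist_le : ∀ x ∈ U, ∀ y ∈ U, dist x y ≤ C * s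
  exists_split : ∃ V : Fin M → Set X, U = ⋃ a, V a ∧
    (∀ a b, a ≠ b → ∀ x ∈ V a, ∀ y ∈ V b, s ≤ C * dist x y) ∧ ∀ a, 𝒰 (ρ * s) (V a)

/-- `U` is, at scale `s` and with constant `C`, split by a regular `M`-ary tree of ratio `ρ`. This is
the largest predicate `𝒰` with `𝒰 s U → Splits 𝒰 M ρ C s U`. -/
def TreeLike (M : ℕ) (ρ C s : ℝ) (U : Set X) : Prop :=
  ∃ 𝒰 : ℝ → Set X → Prop, (∀ s U, 𝒰 s U → Splits 𝒰 M ρ C s U) ∧ 𝒰 s U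

variable {M : ℕ} {ρ C s : ℝ} {U : Set X}

theorem Splits.mono {𝒰 𝒱 : ℝ → Set X → Prop} (h : Splits 𝒰 M ρ C s U)
    (h𝒰 : ∀ s U, 𝒰 s U → 𝒱 s U) : Splits 𝒱 M ρ C s U := by
  obtain ⟨V, hV, hsep, hin⟩ := h.exists_split
  exact ⟨h.pos, h.nonempty, h.isCompact, h.dist_le, V, hV, hsep, fun a => h𝒰 _ _ (hin a)⟩

theorem Splits.of_fintype {𝒰 : ℝ → Set X → Prop} {ι : Type*} [Fintype ι]
    (hcard : Fintype.card ι = M) (hs : 0 < s) (hne : U.Nonempty) (hc : IsCompact U)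
    (hd : ∀ x ∈ U, ∀ y ∈ U, dist x y ≤ C * s) (V : ι → Set X) (hV : U = ⋃ a, V a)
    (hsep : ∀ a b, a ≠ b → ∀ x ∈ V a, ∀ y ∈ V b, s ≤ C * dist x y)
    (hin : ∀ a, 𝒰 (ρ * s) (V a)) : Splits 𝒰 M ρ C s U := by
  let e : Fin M ≃ ι := (Fintype.equivFinOfCardEq hcard).symm
  refine ⟨hs, hne, hc, hd, V ∘ e, ?_, ?_, fun a => hin _⟩
  · rw [hV]
    exact (e.surjective.iUnion_comp V).symm
  · intro a b hab
    exact hsep _ _ (e.injective.ne hab)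

theorem TreeLike.splits (h : TreeLike M ρ C s U) : Splits (TreeLike M ρ C) M ρ C s U := by
  obtain ⟨𝒰, h𝒰, hU⟩ := h
  exact (h𝒰 s U hU).mono fun s U hU => ⟨𝒰, h𝒰, hU⟩

/-- Coinduction up to `TreeLike`. -/
theorem TreeLike.coinduction (𝒰 : ℝ → Set X → Prop)
    (h𝒰 : ∀ s U, 𝒰 s U → Splits (fun s U => 𝒰 s U ∨ TreeLike M ρ C s U) M ρ C s U)
    (hU : 𝒰 s U) : TreeLike M ρ C s U := by
  refine ⟨fun s U => 𝒰 s U ∨ TreeLike M ρ C s U, ?_, Or.inl hU⟩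
  rintro s U (h | h)
  · exact h𝒰 s U h
  · exact h.splits.mono fun s U h => Or.inr h

/-- The same tree serves: both scales are multiplied by `ρ` at each level, so their ratio stays
within the factor `k`. -/
theorem TreeLike.rescale (h : TreeLike M ρ C s U) (hρ : 0 < ρ) (hC : 0 ≤ C) {k s' : ℝ}
    (hk : 0 ≤ k) (hs' : 0 < s') (h1 : s ≤ k * s') (h2 : s' ≤ k * s) :
    TreeLike M ρ (C * k) s' U := by
  refine TreeLike.coinduction (fun s' U => ∃ s, TreeLike M ρ C s U ∧ 0 < s' ∧ s ≤ k * s' ∧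
    s' ≤ k * s) ?_ ⟨s, h, hs', h1, h2⟩
  rintro s' U ⟨s, h, hs', h1, h2⟩
  obtain ⟨hs, hne, hc, hd, V, hV, hsep, hin⟩ := h.splits
  refine ⟨hs', hne, hc, fun x hx y hy => ?_, V, hV, fun a b hab x hx y hy => ?_,
    fun a => Or.inl ⟨ρ * s, hin a, by positivity, ?_, ?_⟩⟩
  · calc dist x y ≤ C * s := hd x hx y hy
      _ ≤ C * (k * s') := by gcongr
      _ = C * k * s' := by ring
  · calc s' ≤ k * s := h2
      _ ≤ k * (C * dist x y) := by gcongr; exact hsep a b hab x hx y hy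
      _ = C * k * dist x y := by ring
  · calc ρ * s ≤ ρ * (k * s') := by gcongr
      _ = k * (ρ * s') := by ring
  · calc ρ * s' ≤ ρ * (k * s) := by gcongr
      _ = k * (ρ * s) := by ring

theorem TreeLike.pos (h : TreeLike M ρ C s U) : 0 < s := h.splits.pos

theorem TreeLike.mono (h : TreeLike M ρ C s U) {C' : ℝ} (hC : C ≤ C') : TreeLike M ρ C' s U := by
  refine TreeLike.coinduction (TreeLike M ρ C) ?_ h
  intro s U h
  obtain ⟨hs, hne, hc, hd, V, hV, hsep, hin⟩ := h.splits
  refine ⟨hs, hne, hc, fun x hx y hy => (hd x hx y hy).trans (by gcongr), V, hV,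
    fun a b hab x hx y hy => (hsep a b hab x hx y hy).trans (by gcongr), fun a => Or.inl (hin a)⟩

theorem TreeLike.coarsen (h : TreeLike M ρ C (ρ * s) U) (hρ : 0 < ρ) (hρ1 : ρ ≤ 1) (hC : 0 ≤ C) :
    TreeLike M ρ (C / ρ) s U := by
  have hs : 0 < s := pos_of_mul_pos_right h.pos hρ.le
  rw [div_eq_mul_inv]
  refine h.rescale hρ hC (by positivity) hs ?_ ?_
  · have : ρ ≤ ρ⁻¹ := hρ1.trans ((one_le_inv₀ hρ).2 hρ1)
    gcongr
  · rw [inv_mul_cancel_left₀ hρ.ne']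

theorem TreeLike.refine_scale (h : TreeLike M ρ C s U) (hρ : 0 < ρ) (hρ1 : ρ ≤ 1) (hC : 0 ≤ C) :
    TreeLike M ρ (C / ρ) (ρ * s) U := by
  have hs : 0 < s := h.pos
  rw [div_eq_mul_inv]
  refine h.rescale hρ hC (by positivity) (by positivity) ?_ ?_
  · rw [inv_mul_cancel_left₀ hρ.ne']
  · have : ρ ≤ ρ⁻¹ := hρ1.trans ((one_le_inv₀ hρ).2 hρ1)
    gcongr

/-- If the pieces of `P` are `P 0, …, P (M - 1)`, then `P ∪ Q` splits into the pieces `P 0 ∪ P 1`,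
`P 2, …, P (M - 1)` and `Q`, the first of which is again of this form. -/
theorem TreeLike.union (hM : 2 ≤ M) (hρ : 0 < ρ) (hρ1 : ρ ≤ 1) (hC : 0 < C) {P Q : Set X}
    (hP : TreeLike M ρ C s P) (hQ : TreeLike M ρ C s Q)
    (hsep : ∀ x ∈ P, ∀ y ∈ Q, s ≤ C * dist x y)
    (hd : ∀ x ∈ P ∪ Q, ∀ y ∈ P ∪ Q, dist x y ≤ C * s) :
    TreeLike M ρ (C / ρ) s (P ∪ Q) := by
  have hCρ : C ≤ C / ρ := le_div_self hC.le hρ hρ1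
  -- Only the diameter bound is relaxed to `C / ρ`: two pieces of `P` lie within distance `C * s`,
  -- which is `C / ρ` times their scale `ρ * s`. The trees of `P` and `Q` keep the constant `C`, so
  -- nothing accumulates down the levels.
  refine TreeLike.coinduction (fun s U => ∃ P Q : Set X, U = P ∪ Q ∧ TreeLike M ρ C s P ∧
    TreeLike M ρ C s Q ∧ (∀ x ∈ P, ∀ y ∈ Q, s ≤ C * dist x y) ∧
    ∀ x ∈ P ∪ Q, ∀ y ∈ P ∪ Q, dist x y ≤ C / ρ * s) ?_
    ⟨P, Q, rfl, hP, hQ, hsep, fun x hx y hy => (hd x hx y hy).trans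
      (mul_le_mul_of_nonneg_right hCρ hP.pos.le)⟩
  clear hP hQ hsep hd
  rintro s _ ⟨P, Q, rfl, hP, hQ, hPQ, hd⟩
  obtain ⟨hs, hne, hc, hdP, V, hV, hsep, hin⟩ := hP.splits
  obtain ⟨n, rfl⟩ : ∃ n, M = n + 2 := ⟨M - 2, by omega⟩
  have hweak : ∀ x y : X, s ≤ C * dist x y → s ≤ C / ρ * dist x y := fun x y h =>
    h.trans (mul_le_mul_of_nonneg_right hCρ dist_nonneg)
  have hsub : ∀ a, V a ⊆ P := fun a => hV ▸ Set.subset_iUnion V a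
  let W : Option (Option (Fin n)) → Set X
    | none => Q
    | some none => V 0 ∪ V 1
    | some (some i) => V i.succ.succ
  refine Splits.of_fintype (ι := Option (Option (Fin n))) (by simp) hs (hne.mono Set.subset_union_left)
    (hc.union hQ.splits.isCompact) hd W ?_ ?_ ?_
  · have h1 : P = V 0 ∪ V 1 ∪ ⋃ i : Fin n, V i.succ.succ := by
      rw [hV]
      ext x
      simp only [Set.mem_iUnion, Set.mem_union, Fin.exists_fin_succ]
      tauto
    rw [h1]
    ext x
    simp only [W, Set.mem_iUnion, Set.mem_union, Option.exists]
    tauto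
  · have hsymm : ∀ A B : Set X, (∀ x ∈ A, ∀ y ∈ B, s ≤ C / ρ * dist x y) →
        ∀ x ∈ B, ∀ y ∈ A, s ≤ C / ρ * dist x y := fun A B h x hx y hy => by
      rw [dist_comm]; exact h y hy x hx
    have hQ' : ∀ A ⊆ P, ∀ x ∈ A, ∀ y ∈ Q, s ≤ C / ρ * dist x y := fun A hA x hx y hy =>
      hweak _ _ (hPQ x (hA hx) y hy)
    have h01 : ∀ i : Fin n, ∀ x ∈ V 0 ∪ V 1, ∀ y ∈ V i.succ.succ, s ≤ C / ρ * dist x y := by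
      rintro i x (hx | hx) y hy
      · exact hweak _ _ (hsep _ _ (by simp [Fin.ext_iff]) x hx y hy)
      · exact hweak _ _ (hsep _ _ (by simp [Fin.ext_iff]) x hx y hy)
    rintro (_ | _ | i) (_ | _ | j) hab
    · exact absurd rfl hab
    · exact hsymm _ _ (hQ' _ (Set.union_subset (hsub 0) (hsub 1)))
    · exact hsymm _ _ (hQ' _ (hsub _))
    · exact hQ' _ (Set.union_subset (hsub 0) (hsub 1))
    · exact absurd rfl hab
    · exact h01 j
    · exact hQ' _ (hsub _)
    · exact hsymm _ _ (h01 i)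
    · intro x hx y hy
      exact hweak _ _ (hsep _ _ (fun h => hab (by simpa using h)) x hx y hy)
  · rintro (_ | _ | i)
    -- `Q` is passed down uncut, hence one scale too large; this costs one factor `ρ⁻¹`, after which
    -- its own tree is followed.
    · exact Or.inr (hQ.refine_scale hρ hρ1 hC.le)
    · refine Or.inl ⟨V 0, V 1, rfl, hin 0, hin 1, fun x hx y hy => ?_, fun x hx y hy => ?_⟩
      · exact (mul_le_of_le_one_left hs.le hρ1).trans (hsep _ _ (by simp) x hx y hy)
      · have hsub' := Set.union_subset (hsub 0) (hsub 1)
        rw [← mul_assoc, div_mul_cancel₀ _ hρ.ne']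
        exact hdP x (hsub' hx) y (hsub' hy)
    · exact Or.inr ((hin _).mono hCρ)

/-- The pieces are adjoined one at a time, each at the cost of a factor `ρ⁻¹`. -/
theorem TreeLike.biUnion (hM : 2 ≤ M) (hρ : 0 < ρ) (hρ1 : ρ ≤ 1) (hC : 0 < C) {ι : Type*}
    (t : Finset ι) (ht : t.Nonempty) (V : ι → Set X)
    (hV : ∀ i ∈ t, TreeLike M ρ C s (V i))
    (hsep : ∀ i ∈ t, ∀ j ∈ t, i ≠ j → ∀ x ∈ V i, ∀ y ∈ V j, s ≤ C * dist x y)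
    (hd : ∀ x ∈ ⋃ i ∈ t, V i, ∀ y ∈ ⋃ i ∈ t, V i, dist x y ≤ C * s) :
    TreeLike M ρ (C / ρ ^ t.card) s (⋃ i ∈ t, V i) := by
  classical
  induction ht using Finset.Nonempty.cons_induction with
  | singleton i =>
    simp only [Finset.mem_singleton, Set.iUnion_iUnion_eq_left, Finset.card_singleton, pow_one]
    exact (hV i (by simp)).mono (le_div_self hC.le hρ hρ1)
  | cons i t hi ht ih =>
    have hU : ⋃ j ∈ Finset.cons i t hi, V j = (⋃ j ∈ t, V j) ∪ V i := by
      ext x; simp [or_comm]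
    have hle : C ≤ C / ρ ^ t.card := le_div_self hC.le (by positivity) (pow_le_one₀ hρ.le hρ1)
    have hs : 0 < s := (hV i (by simp)).pos
    rw [hU] at hd ⊢
    have h1 := ih (fun j hj => hV j (by simp [hj]))
      (fun j hj k hk => hsep j (by simp [hj]) k (by simp [hk]))
      (fun x hx y hy => hd x (Or.inl hx) y (Or.inl hy))
    have h2 := TreeLike.union hM hρ hρ1 (by positivity) h1 ((hV i (by simp)).mono hle) ?_ ?_
    · rwa [div_div, ← pow_succ, ← Finset.card_cons hi] at h2
    · intro x hx y hy
      simp only [Set.mem_iUnion] at hx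
      obtain ⟨j, hj, hx⟩ := hx
      refine (hsep j (by simp [hj]) i (by simp) ?_ x hx y hy).trans (by gcongr)
      rintro rfl
      exact hi hj
    · exact fun x hx y hy => (hd x hx y hy).trans (by gcongr)

/-- Uniform version of `TreeLike.biUnion` for a bounded number of pieces. -/
theorem TreeLike.iUnion_fintype (hM : 2 ≤ M) (hρ : 0 < ρ) (hρ1 : ρ ≤ 1) (hC : 0 < C) {ι : Type*}
    [Fintype ι] [Nonempty ι] {n : ℕ} (hn : Fintype.card ι ≤ n) (V : ι → Set X)
    (hV : ∀ i, TreeLike M ρ C s (V i))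
    (hsep : ∀ i j, i ≠ j → ∀ x ∈ V i, ∀ y ∈ V j, s ≤ C * dist x y)
    (hd : ∀ x ∈ ⋃ i, V i, ∀ y ∈ ⋃ i, V i, dist x y ≤ C * s) :
    TreeLike M ρ (C / ρ ^ n) s (⋃ i, V i) := by
  have h := TreeLike.biUnion hM hρ hρ1 hC (s := s) Finset.univ Finset.univ_nonempty V
    (fun i _ => hV i) (fun i _ j _ => hsep i j) (by simpa using hd)
  simp only [Finset.mem_univ, Set.iUnion_true, Finset.card_univ] at h
  refine h.mono ?_
  have : ρ ^ n ≤ ρ ^ Fintype.card ι := pow_le_pow_of_le_one hρ.le hρ1 hn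
  gcongr

/-- A set split by an `M`-ary tree can also be split into `h` such sets, for `1 ≤ h ≤ M`. -/
theorem TreeLike.exists_split (hM : 2 ≤ M) (hρ : 0 < ρ) (hρ1 : ρ ≤ 1) (hC : 0 < C)
    (hU : TreeLike M ρ C s U) {h : ℕ} (h0 : 0 < h) (hh : h ≤ M) :
    ∃ V : Fin h → Set X, U = ⋃ a, V a ∧
      (∀ a b, a ≠ b → ∀ x ∈ V a, ∀ y ∈ V b, s ≤ C * dist x y) ∧
      ∀ a, TreeLike M ρ (C / ρ / ρ ^ M / ρ) s (V a) := by
  obtain ⟨hs, hne, hc, hd, V, hV, hsep, hin⟩ := hU.splits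
  -- The first `h - 1` pieces stay alone and all the others are merged into the last part.
  let f : Fin M → Fin h := fun a => ⟨min a (h - 1), by omega⟩
  have hf : ∀ b : Fin h, Nonempty {a // f a = b} := fun b =>
    ⟨⟨⟨b, b.2.trans_le hh⟩, by ext; simp only [f]; omega⟩⟩
  refine ⟨fun b => ⋃ a : {a // f a = b}, V a, ?_, ?_, fun b => ?_⟩
  · rw [hV]
    ext x
    simp
  · intro b b' hb x hx y hy
    simp only [Set.mem_iUnion] at hx hy
    obtain ⟨⟨a, rfl⟩, hx⟩ := hx
    obtain ⟨⟨a', rfl⟩, hy⟩ := hy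
    exact hsep a a' (fun h => hb (h ▸ rfl)) x hx y hy
  · have hCρ : C ≤ C / ρ := le_div_self hC.le hρ hρ1
    have := hf b
    refine TreeLike.coarsen ?_ hρ hρ1 (by positivity)
    refine TreeLike.iUnion_fintype hM hρ hρ1 (by positivity)
      ((Fintype.card_subtype_le _).trans (by simp)) _ (fun a => (hin a).mono hCρ) ?_ ?_
    · intro a a' ha x hx y hy
      calc ρ * s ≤ s := mul_le_of_le_one_left hs.le hρ1
        _ ≤ C * dist x y := hsep _ _ (fun h => ha (Subtype.ext h)) x hx y hy
        _ ≤ C / ρ * dist x y := by gcongr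
    · intro x hx y hy
      rw [← mul_assoc, div_mul_cancel₀ _ hρ.ne']
      have hsub : (⋃ a : {a // f a = b}, V a) ⊆ U := by
        rw [hV]
        exact Set.iUnion_subset fun a => Set.subset_iUnion V a
      exact hd x (hsub hx) y (hsub hy)

end TreeLike

/-! ### Bilipschitz equivalence and symbolic spaces. -/

theorem BilipschitzEquivalent.symm {B B' : Type*} [MetricSpace B] [MetricSpace B']
    (h : BilipschitzEquivalent B B') : BilipschitzEquivalent B' B := by
  obtain ⟨f, C, hC, h⟩ := h
  refine ⟨f.symm, C, hC, fun x y => ?_⟩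
  obtain ⟨h1, h2⟩ := h (f.symm x) (f.symm y)
  simp only [Equiv.apply_symm_apply] at h1 h2
  exact ⟨(inv_mul_le_iff₀ hC).2 h2, (inv_mul_le_iff₀ hC).1 h1⟩

theorem BilipschitzEquivalent.trans {B B' B'' : Type*} [MetricSpace B] [MetricSpace B']
    [MetricSpace B''] (h : BilipschitzEquivalent B B') (h' : BilipschitzEquivalent B' B'') :
    BilipschitzEquivalent B B'' := by
  obtain ⟨f, C, hC, h⟩ := h
  obtain ⟨f', C', hC', h'⟩ := h'
  refine ⟨f.trans f', C' * C, by positivity, fun x y => ⟨?_, ?_⟩⟩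
  · calc (C' * C)⁻¹ * dist x y = C'⁻¹ * (C⁻¹ * dist x y) := by rw [mul_inv, mul_assoc]
      _ ≤ C'⁻¹ * dist (f x) (f y) := by gcongr; exact (h x y).1
      _ ≤ _ := (h' _ _).1
  · calc _ ≤ C' * dist (f x) (f y) := (h' _ _).2
      _ ≤ C' * (C * dist x y) := by gcongr; exact (h x y).2
      _ = _ := by ring

namespace SymbolicSpace

theorem dist_eq {m : ℕ} {r : Set.Ioo (0 : ℝ) 1} {x y : SymbolicSpace m r} (h : x ≠ y) :
    dist x y = (r : ℝ) ^ PiNat.firstDiff (E := fun _ => Fin m) x y := by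
  change symbolicDist x y = _
  simp [symbolicDist, h]

/-- Reading words in blocks of `N` letters. -/
theorem bilipschitzEquivalent_pow (m N : ℕ) (r ρ : Set.Ioo (0 : ℝ) 1) (hN : 0 < N)
    (hρ : (ρ : ℝ) = (r : ℝ) ^ N) :
    BilipschitzEquivalent (SymbolicSpace m r) (SymbolicSpace (m ^ N) ρ) := by
  obtain ⟨r, hr0, hr1⟩ := r
  have : NeZero N := ⟨hN.ne'⟩
  let block : Fin (m ^ N) ≃ (Fin N → Fin m) := finFunctionFinEquiv.symm
  let f : SymbolicSpace m ⟨r, hr0, hr1⟩ ≃ SymbolicSpace (m ^ N) ρ :=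
    { toFun := fun x k => block.symm fun i => x (N * k + i)
      invFun := fun y n => block (y (n / N)) (Fin.ofNat N n)
      left_inv := fun x => by
        funext n
        simp [Fin.ofNat, Nat.div_add_mod]
      right_inv := fun y => by
        funext k
        rw [Equiv.symm_apply_eq]
        funext i
        have h1 : (N * k + i) / N = k := by
          rw [Nat.mul_add_div hN, Nat.div_eq_of_lt i.2, add_zero]
        have h2 : Fin.ofNat N (N * k + i) = i := by
          ext
          simp [Fin.ofNat, Nat.mod_eq_of_lt i.2]
        simp only [h1, h2] }
  have hf : ∀ x y : SymbolicSpace m ⟨r, hr0, hr1⟩, ∀ k,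
      f x k = f y k ↔ ∀ i < N, x (N * k + i) = y (N * k + i) := fun x y k => by
    change block.symm _ = block.symm _ ↔ _
    rw [block.symm.injective.eq_iff, funext_iff, Fin.forall_iff]
  refine ⟨f, (r ^ N)⁻¹, by positivity, fun x y => ?_⟩
  by_cases hxy : x = y
  · simp [hxy]
  have hfxy : f x ≠ f y := f.injective.ne hxy
  rw [dist_eq hxy, dist_eq hfxy, hρ, ← pow_mul, inv_inv]
  set n := PiNat.firstDiff (E := fun _ => Fin m) x y with hn
  set k := PiNat.firstDiff (E := fun _ => Fin (m ^ N)) (f x) (f y) with hk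
  -- The first differing letter `n` lies in the first differing block `k`, so `r ^ n` and `r ^ (N *
  -- k)` agree up to a factor `r ^ N`.
  have hle : N * k ≤ n := by
    by_contra! hlt
    refine PiNat.apply_firstDiff_ne (E := fun _ => Fin m) hxy ?_
    rw [← hn]
    have h := (hf x y (n / N)).1
      (PiNat.apply_eq_of_lt_firstDiff (E := fun _ => Fin (m ^ N)) (by
        rw [← hk]; exact Nat.div_lt_of_lt_mul hlt)) (n % N) (Nat.mod_lt _ hN)
    rwa [Nat.div_add_mod] at h
  have hlt : n ≤ N + N * k := by
    by_contra! hlt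
    refine PiNat.apply_firstDiff_ne (E := fun _ => Fin (m ^ N)) hfxy ?_
    rw [← hk, hf]
    intro i hi
    exact PiNat.apply_eq_of_lt_firstDiff (E := fun _ => Fin m) (by rw [← hn]; omega)
  change r ^ N * r ^ n ≤ r ^ (N * k) ∧ r ^ (N * k) ≤ (r ^ N)⁻¹ * r ^ n
  constructor
  · rw [← pow_add]
    exact pow_le_pow_of_le_one hr0.le hr1.le (by omega)
  · rw [le_inv_mul_iff₀ (by positivity), ← pow_add]
    exact pow_le_pow_of_le_one hr0.le hr1.le hlt

end SymbolicSpace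

/-- A point is coded by the pieces containing it, which are unique because pieces are separated. If
two codes first differ at `k`, both points lie in one piece of level `k`, which bounds their
distance above, and in different children of it, which bounds it below. -/
theorem TreeLike.bilipschitzEquivalent {X : Type*} [MetricSpace X] {M : ℕ}
    {ρ : Set.Ioo (0 : ℝ) 1} {C s : ℝ} (hC : 0 < C) {U : Set X} (hU : TreeLike M ρ C s U) :
    BilipschitzEquivalent U (SymbolicSpace M ρ) := by
  classical
  have hs : 0 < s := hU.pos
  have hρ := ρ.2.1
  let σ : Type _ := {q : ℝ × Set X // TreeLike M ρ C q.1 q.2}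
  have hsplit : ∀ q : σ, ∃ ch : Fin M → σ, q.1.2 = ⋃ a, (ch a).1.2 ∧
      (∀ a b, a ≠ b → ∀ x ∈ (ch a).1.2, ∀ y ∈ (ch b).1.2, q.1.1 ≤ C * dist x y) ∧
      ∀ a, (ch a).1.1 = ρ * q.1.1 := by
    rintro ⟨⟨t, W⟩, h⟩
    obtain ⟨V, hV, hsep, hin⟩ := h.splits.exists_split
    exact ⟨fun a => ⟨(ρ * t, V a), hin a⟩, hV, hsep, fun a => rfl⟩
  choose ch hch hsep hscale using hsplit
  have hsub : ∀ q a, (ch q a).1.2 ⊆ q.1.2 := fun q a => by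
    rw [hch q]
    exact Set.subset_iUnion (fun a => (ch q a).1.2) a
  have huniq : ∀ q a b x, x ∈ (ch q a).1.2 → x ∈ (ch q b).1.2 → a = b := by
    intro q a b x ha hb
    by_contra hab
    have := hsep q a b hab x ha x hb
    rw [dist_self, mul_zero] at this
    exact this.not_gt q.2.pos
  let root : σ := ⟨(s, U), hU⟩
  let node : SymbolicSpace M ρ → ℕ → σ := fun w n => Nat.rec root (fun k q => ch q (w k)) n
  have node_succ : ∀ w n, node w (n + 1) = ch (node w n) (w n) := fun w n => rfl
  have node_scale : ∀ w n, (node w n).1.1 = (ρ : ℝ) ^ n * s := by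
    intro w n
    induction n with
    | zero => simp [node, root]
    | succ n ih => rw [node_succ, hscale, ih]; ring
  have node_congr : ∀ w w' n, (∀ k < n, w k = w' k) → node w n = node w' n := by
    intro w w' n h
    induction n with
    | zero => rfl
    | succ n ih => rw [node_succ, node_succ, ih fun k hk => h k (by omega), h n (by omega)]
  have node_anti : ∀ w n, (node w (n + 1)).1.2 ⊆ (node w n).1.2 := fun w n => hsub _ _
  have exists_word : ∀ x : U, ∃ w : SymbolicSpace M ρ, ∀ n, (x : X) ∈ (node w n).1.2 := by
    rintro ⟨x, hx⟩
    have hloc : ∀ q : σ, ∃ a, x ∈ q.1.2 → x ∈ (ch q a).1.2 := by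
      intro q
      by_cases hq : x ∈ q.1.2
      · rw [hch q] at hq
        obtain ⟨a, ha⟩ := Set.mem_iUnion.1 hq
        exact ⟨a, fun _ => ha⟩
      -- For a piece that misses `x` any letter will do; the splitting of the root shows that there
      -- is one.
      · have : x ∈ ⋃ a, (ch root a).1.2 := hch root ▸ hx
        obtain ⟨a, -⟩ := Set.mem_iUnion.1 this
        exact ⟨a, fun h => absurd h hq⟩
    choose letter hletter using hloc
    let st : ℕ → σ := fun n => Nat.rec root (fun _ q => ch q (letter q)) n
    let w : SymbolicSpace M ρ := fun k => letter (st k)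
    have hst : ∀ n, node w n = st n := by
      intro n
      induction n with
      | zero => rfl
      | succ n ih => rw [node_succ w n, ih]
    refine ⟨w, fun n => ?_⟩
    rw [hst]
    induction n with
    | zero => exact hx
    | succ n ih => exact hletter _ ih
  choose f hf using exists_word
  have f_unique : ∀ (x : U) (w : SymbolicSpace M ρ), (∀ n, (x : X) ∈ (node w n).1.2) → f x = w := by
    intro x w hw
    by_contra hne
    refine PiNat.apply_firstDiff_ne (E := fun _ => Fin M) hne ?_
    set k := PiNat.firstDiff (E := fun _ => Fin M) (f x) w
    have hk : node (f x) k = node w k := node_congr _ _ _ fun i hi =>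
      PiNat.apply_eq_of_lt_firstDiff (E := fun _ => Fin M) hi
    have h1 := hf x (k + 1)
    have h2 := hw (k + 1)
    rw [node_succ (f x) k] at h1
    rw [node_succ w k] at h2
    rw [hk] at h1
    exact huniq _ _ _ _ h1 h2
  have hdist : ∀ (x y : U) w n, (x : X) ∈ (node w n).1.2 → (y : X) ∈ (node w n).1.2 →
      dist x y ≤ C * ((ρ : ℝ) ^ n * s) := by
    intro x y w n hx hy
    rw [← node_scale w n]
    exact (node w n).2.splits.dist_le x hx y hy
  have f_inj : Function.Injective f := by
    intro x y hxy
    have h : ∀ n, dist x y ≤ C * ((ρ : ℝ) ^ n * s) := fun n =>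
      hdist x y (f x) n (hf x n) (hxy ▸ hf y n)
    have hlim : Filter.Tendsto (fun n : ℕ => C * ((ρ : ℝ) ^ n * s)) Filter.atTop (nhds 0) := by
      simpa using ((tendsto_pow_atTop_nhds_zero_of_lt_one hρ.le ρ.2.2).mul_const s).const_mul C
    exact dist_le_zero.1 (ge_of_tendsto' hlim h)
  have f_surj : Function.Surjective f := by
    intro w
    -- Cantor's intersection theorem along the branch `w`.
    obtain ⟨x, hx⟩ := IsCompact.nonempty_iInter_of_sequence_nonempty_isCompact_isClosed
      (fun n => (node w n).1.2) (node_anti w) (fun n => (node w n).2.splits.nonempty)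
      (node w 0).2.splits.isCompact (fun n => (node w n).2.splits.isCompact.isClosed)
    rw [Set.mem_iInter] at hx
    exact ⟨⟨x, hx 0⟩, f_unique _ _ hx⟩
  refine ⟨Equiv.ofBijective f ⟨f_inj, f_surj⟩, max (C * s) (C / s),
    lt_max_of_lt_left (by positivity), fun x y => ?_⟩
  change _ * dist x y ≤ dist (f x) (f y) ∧ dist (f x) (f y) ≤ _
  by_cases hxy : x = y
  · simp [hxy]
  have hne : f x ≠ f y := f_inj.ne hxy
  rw [SymbolicSpace.dist_eq hne]
  set k := PiNat.firstDiff (E := fun _ => Fin M) (f x) (f y) with hk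
  have hnode : node (f x) k = node (f y) k := node_congr _ _ _ fun i hi =>
    PiNat.apply_eq_of_lt_firstDiff (E := fun _ => Fin M) hi
  constructor
  · rw [inv_mul_le_iff₀ (lt_max_of_lt_left (by positivity))]
    calc dist x y ≤ C * ((ρ : ℝ) ^ k * s) := hdist x y (f x) k (hf x k) (hnode ▸ hf y k)
      _ = C * s * (ρ : ℝ) ^ k := by ring
      _ ≤ _ := by gcongr; exact le_max_left _ _
  · have h := hsep (node (f x) k) (f x k) (f y k)
      (PiNat.apply_firstDiff_ne (E := fun _ => Fin M) hne) x (hf x (k + 1)) y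
      (by rw [hnode]; exact hf y (k + 1))
    rw [node_scale (f x) k] at h
    calc (ρ : ℝ) ^ k = (ρ : ℝ) ^ k * s / s := by rw [mul_div_cancel_right₀ _ hs.ne']
      _ ≤ C * dist (x : X) y / s := by gcongr
      _ = C / s * dist x y := by rw [Subtype.dist_eq]; ring
      _ ≤ _ := by gcongr; exact le_max_right _ _

/-! ### Integral eigenvectors. -/

section Eigenvector

variable {V : Type*} [Fintype V]

/-- An integer matrix with a natural eigenvalue and a positive real eigenvector has a positive
natural eigenvector: the rational solutions are dense in the real solutions. -/
theorem Matrix.exists_nat_eigenvector (A : Matrix V V ℕ) (m : ℕ) (v : V → ℝ) (hv : ∀ i, 0 < v i)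
    (hA : ∀ i, ∑ j, (A i j : ℝ) * v j = m * v i) :
    ∃ w : V → ℕ, (∀ i, 0 < w i) ∧ ∀ i, ∑ j, A i j * w j = m * w i := by
  classical
  let S : Submodule ℚ ℝ := Submodule.span ℚ (Set.range v)
  have : FiniteDimensional ℚ S := FiniteDimensional.span_of_finite ℚ (Set.finite_range v)
  let b := Module.finBasis ℚ S
  let x : V → S := fun i => ⟨v i, Submodule.subset_span ⟨i, rfl⟩⟩
  have hx : ∀ i, ∑ j, (A i j : ℚ) • x j = (m : ℚ) • x i := by
    intro i
    apply Subtype.ext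
    simp only [AddSubmonoidClass.coe_finsetSum, SetLike.val_smul, x, Rat.smul_def, Rat.cast_natCast]
    exact hA i
  have hrepr : ∀ i l, ∑ j, (A i j : ℚ) * b.repr (x j) l = m * b.repr (x i) l := by
    intro i l
    have := congrArg (fun y => b.repr y l) (hx i)
    simpa [map_sum, Finsupp.finsetSum_apply] using this
  -- Replace the basis `b` of the rational span of the entries of `v` by arbitrary numbers `β`. By
  -- `hrepr` the eigenvector equation survives, and positivity is an open condition that holds at `β
  -- = b`, so a rational `β` can be chosen.
  let f : (Fin (Module.finrank ℚ S) → ℝ) → V → ℝ := fun β i => ∑ l, (b.repr (x i) l : ℝ) * β l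
  have hfc : Continuous f := by fun_prop
  have hfv : f (fun l => (b l : ℝ)) = v := by
    funext i
    have h : v i = ((∑ l, b.repr (x i) l • b l : S) : ℝ) := by rw [b.sum_repr]
    rw [h]
    simp only [f, AddSubmonoidClass.coe_finsetSum, SetLike.val_smul, Rat.smul_def]
  have hopen : IsOpen {u : V → ℝ | ∀ i, 0 < u i} := by
    simp only [Set.ofPred_forall]
    exact isOpen_iInter_of_finite fun i => isOpen_lt continuous_const (continuous_apply i)
  have hdense : DenseRange (Pi.map fun (_ : Fin (Module.finrank ℚ S)) (t : ℚ) => (t : ℝ)) :=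
    DenseRange.piMap fun _ => Rat.denseRange_cast
  obtain ⟨β, hβ⟩ := hdense.exists_mem_open (hopen.preimage hfc) ⟨fun l => (b l : ℝ), by
    rw [Set.mem_preimage, hfv]; exact hv⟩
  let u : V → ℚ := fun i => ∑ l, b.repr (x i) l * β l
  have hu : ∀ i, 0 < u i := by
    intro i
    have h := hβ i
    have h' : f (Pi.map (fun _ (t : ℚ) => (t : ℝ)) β) i = (u i : ℝ) := by
      simp [f, u]
    rw [h'] at h
    exact_mod_cast h
  have huA : ∀ i, ∑ j, (A i j : ℚ) * u j = m * u i := by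
    intro i
    simp only [u, Finset.mul_sum]
    rw [Finset.sum_comm]
    refine Finset.sum_congr rfl fun l _ => ?_
    simp only [← mul_assoc]
    rw [← Finset.sum_mul, hrepr]
  let D : ℕ := ∏ i, (u i).den
  have hD : 0 < D := Finset.prod_pos fun i _ => (u i).pos
  have hw : ∀ i, ∃ w : ℕ, (w : ℚ) = D * u i := by
    intro i
    obtain ⟨t, ht⟩ : (u i).den ∣ D := Finset.dvd_prod_of_mem _ (Finset.mem_univ i)
    refine ⟨t * (u i).num.natAbs, ?_⟩
    have h1 : (((u i).num.natAbs : ℕ) : ℚ) = (u i).num := by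
      rw [← Int.cast_natCast, Int.natAbs_of_nonneg (Rat.num_nonneg.2 (hu i).le)]
    have h2 : ((u i).num : ℚ) = (u i).den * u i := (Rat.den_mul_eq_num (u i)).symm
    rw [Nat.cast_mul, h1, h2, ht]
    push_cast
    ring
  choose w hw using hw
  refine ⟨w, fun i => ?_, fun i => ?_⟩
  · have : (0 : ℚ) < w i := by
      rw [hw]
      exact mul_pos (by exact_mod_cast hD) (hu i)
    exact_mod_cast this
  · have : (∑ j, (A i j : ℚ) * w j) = m * w i := by
      simp only [hw]
      rw [mul_left_comm, ← huA, Finset.mul_sum]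
      exact Finset.sum_congr rfl fun j _ => by ring
    exact_mod_cast this

end Eigenvector

/-! ### Partitions into groups of equal weight. -/

/-- A multiset of `n k` objects of weight `v k`, `k ∈ T`, of total weight `q * W` can be divided into
`q` groups of weight exactly `W`: divide the objects of each kind evenly, and correct the defects
with multiples of a Bézout relation for the greatest common divisor `g` of the weights. -/
theorem exists_equal_weight_partition {V : Type*} (T : Finset V) (v : V → ℕ) {g : ℕ} (hg : 0 < g)
    (hgv : ∀ k ∈ T, g ∣ v k) (c : V → ℤ) (hc : ∑ k ∈ T, (v k : ℤ) * c k = g) (n : V → ℕ)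
    {q W : ℕ} (hq : 0 < q) (hsum : ∑ k ∈ T, n k * v k = q * W) (hgW : g ∣ W)
    (hn : ∀ k ∈ T, (c k).natAbs * (∑ l ∈ T, v l) * q ≤ n k) :
    ∃ a : Fin q → V → ℕ, (∀ k ∈ T, ∑ i, a i k = n k) ∧ ∀ i, ∑ k ∈ T, a i k * v k = W := by
  classical
  set S : ℕ := ∑ l ∈ T, v l with hS
  let e : Fin q → V → ℕ := fun i k => if (i : ℕ) < n k % q then 1 else 0
  have he : ∀ k, ∑ i, e i k = n k % q := by
    intro k
    have hlt : n k % q < q := Nat.mod_lt _ hq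
    rw [Fin.sum_univ_eq_sum_range (fun i => if i < n k % q then 1 else 0) q, Finset.sum_boole]
    have : (Finset.range q).filter (fun i => i < n k % q) = Finset.range (n k % q) := by
      ext i
      simp only [Finset.mem_filter, Finset.mem_range]
      omega
    simp [this]
  have hev : ∀ k, (∑ i, (n k / q + e i k)) = n k := by
    intro k
    rw [Finset.sum_add_distrib, he]
    simp [Nat.div_add_mod]
  have hdvd : ∀ i, (g : ℤ) ∣ (∑ k ∈ T, ((n k / q + e i k : ℕ) : ℤ) * v k) - W := by
    intro i
    refine dvd_sub (Finset.dvd_sum fun k hk => ?_) (by exact_mod_cast hgW)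
    exact Dvd.dvd.mul_left (by exact_mod_cast hgv k hk) _
  -- `g * δ i` is the excess weight of group `i`. It is removed by taking `δ i * c k` objects of
  -- each kind `k` away; as the `δ i` sum to zero, the total of each kind is unchanged.
  choose δ hδ using hdvd
  have hg' : (0 : ℤ) < g := by exact_mod_cast hg
  have hδsum : ∑ i, δ i = 0 := by
    have h : (g : ℤ) * ∑ i, δ i = 0 := by
      rw [Finset.mul_sum, ← Finset.sum_congr rfl fun i _ => hδ i, Finset.sum_sub_distrib,
        Finset.sum_comm]
      simp only [← Finset.sum_mul, ← Nat.cast_sum, hev]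
      have h2 : ((∑ k ∈ T, n k * v k : ℕ) : ℤ) = ((q * W : ℕ) : ℤ) := by rw [hsum]
      push_cast at h2
      simp [h2]
    exact (mul_eq_zero.1 h).resolve_left hg'.ne'
  -- Rounding moves each share by at most one object of each kind, so the excess is at most `S`,
  -- whatever the size of `n`.
  have hδle : ∀ i, |δ i| ≤ S := by
    intro i
    have hq' : (0 : ℤ) < q := by exact_mod_cast hq
    have h1 : (q : ℤ) * (g * δ i) = ∑ k ∈ T, ((q * e i k : ℤ) - (n k % q : ℕ)) * v k := by
      rw [← hδ, mul_sub, show (q : ℤ) * W = ((q * W : ℕ) : ℤ) by push_cast; rfl, ← hsum,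
        Finset.mul_sum, Nat.cast_sum, ← Finset.sum_sub_distrib]
      refine Finset.sum_congr rfl fun k _ => ?_
      have h : (n k : ℤ) = q * ((n k / q : ℕ) : ℤ) + ((n k % q : ℕ) : ℤ) := by
        exact_mod_cast (Nat.div_add_mod (n k) q).symm
      push_cast at h ⊢
      nth_rewrite 2 [h]
      ring
    have h2 : |(q : ℤ) * (g * δ i)| ≤ q * S := by
      rw [h1, hS, Nat.cast_sum, Finset.mul_sum]
      refine (Finset.abs_sum_le_sum_abs _ _).trans (Finset.sum_le_sum fun k _ => ?_)
      rw [abs_mul, Nat.abs_cast]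
      refine mul_le_mul_of_nonneg_right ?_ (by positivity)
      have hlt : ((n k % q : ℕ) : ℤ) < q := by exact_mod_cast Nat.mod_lt _ hq
      have h0 : (0 : ℤ) ≤ ((n k % q : ℕ) : ℤ) := by positivity
      rw [abs_le]
      by_cases h : (i : ℕ) < n k % q
      · simp only [e, h, if_true]
        push_cast at *
        constructor <;> linarith
      · simp only [e, h, if_false]
        push_cast at *
        constructor <;> linarith
    rw [abs_mul, abs_mul, abs_of_pos hq', abs_of_pos hg'] at h2
    have h3 := le_of_mul_le_mul_left h2 hq'
    have h4 : 1 * |δ i| ≤ g * |δ i| :=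
      mul_le_mul_of_nonneg_right (by exact_mod_cast hg) (abs_nonneg _)
    linarith
  have hpos : ∀ i, ∀ k ∈ T, 0 ≤ ((n k / q + e i k : ℕ) : ℤ) - δ i * c k := by
    intro i k hk
    have h1 : (c k).natAbs * S ≤ n k / q := (Nat.le_div_iff_mul_le hq).2 (hn k hk)
    have h2 : δ i * c k ≤ S * |c k| := by
      refine (le_abs_self _).trans ?_
      rw [abs_mul]
      exact mul_le_mul_of_nonneg_right (hδle i) (abs_nonneg _)
    have h3 : ((c k).natAbs : ℤ) * S ≤ ((n k / q : ℕ) : ℤ) := by exact_mod_cast h1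
    rw [Int.natCast_natAbs] at h3
    have h4 : ((n k / q + e i k : ℕ) : ℤ) = ((n k / q : ℕ) : ℤ) + e i k := by push_cast; rfl
    have h5 : (0 : ℤ) ≤ e i k := by positivity
    rw [h4]
    linarith
  have ha : ∀ i, ∀ k ∈ T, (((((n k / q + e i k : ℕ) : ℤ) - δ i * c k).toNat : ℕ) : ℤ) =
      ((n k / q + e i k : ℕ) : ℤ) - δ i * c k := fun i k hk => Int.toNat_of_nonneg (hpos i k hk)
  refine ⟨fun i k => (((n k / q + e i k : ℕ) : ℤ) - δ i * c k).toNat, fun k hk => ?_, fun i => ?_⟩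
  · apply Nat.cast_injective (R := ℤ)
    rw [Nat.cast_sum, Finset.sum_congr rfl fun i _ => ha i k hk, Finset.sum_sub_distrib, ← Finset.sum_mul, hδsum,
      ← Nat.cast_sum, hev]
    simp
  · apply Nat.cast_injective (R := ℤ)
    simp only [Nat.cast_sum, Nat.cast_mul]
    rw [Finset.sum_congr rfl fun k hk => by rw [ha i k hk]]
    have h1 : ∑ k ∈ T, (((n k / q + e i k : ℕ) : ℤ) - δ i * c k) * v k =
        ∑ k ∈ T, ((n k / q + e i k : ℕ) : ℤ) * v k - δ i * ∑ k ∈ T, (v k : ℤ) * c k := by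
      rw [Finset.mul_sum, ← Finset.sum_sub_distrib]
      exact Finset.sum_congr rfl fun k _ => by ring
    have h2 := hδ i
    rw [h1, hc]
    linarith

theorem exists_bezout {V : Type*} (T : Finset V) (v : V → ℕ) (hv : ∃ k ∈ T, 0 < v k) :
    ∃ g : ℕ, 0 < g ∧ (∀ k ∈ T, g ∣ v k) ∧ ∃ c : V → ℤ, ∑ k ∈ T, (v k : ℤ) * c k = g := by
  obtain ⟨c, hc⟩ := Finset.gcd_eq_sum_mul T (fun k => (v k : ℤ))
  set G := T.gcd fun k => (v k : ℤ) with hG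
  have hdvd : ∀ k ∈ T, G ∣ (v k : ℤ) := fun k hk => Finset.gcd_dvd hk
  refine ⟨G.natAbs, ?_, fun k hk => Int.natAbs_dvd_natAbs.2 (hdvd k hk), ?_⟩
  · obtain ⟨k, hk, hvk⟩ := hv
    rw [Int.natAbs_pos]
    intro h0
    have := hdvd k hk
    rw [h0, zero_dvd_iff] at this
    omega
  · rcases Int.natAbs_eq G with h | h
    · exact ⟨c, by rw [← hc]; exact h⟩
    · refine ⟨fun k => -c k, ?_⟩
      simp only [mul_neg, Finset.sum_neg_distrib]
      rw [← hc]
      omega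

theorem Matrix.nat_mul_apply_pos_iff {V : Type*} [Fintype V] (B B' : Matrix V V ℕ) (j l : V) :
    0 < (B * B') j l ↔ ∃ k, 0 < B j k ∧ 0 < B' k l := by
  rw [Matrix.mul_apply, Finset.sum_pos_iff]
  simp [Nat.pos_iff_ne_zero]

/-! ### Powers of nonnegative matrices and closed classes. -/

section NonnegativeMatrix

variable {V : Type*} [Fintype V] [DecidableEq V]

theorem Matrix.pow_mul_weight (B : Matrix V V ℕ) (v : V → ℕ) (Q : ℕ)
    (hB : ∀ j, ∑ k, B j k * v k = Q * v j) (N : ℕ) (j : V) :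
    ∑ k, (B ^ N) j k * v k = Q ^ N * v j := by
  induction N generalizing j with
  | zero => simp [Matrix.one_apply]
  | succ N ih =>
    simp only [pow_succ' B, Matrix.mul_apply, Finset.sum_mul]
    rw [Finset.sum_comm]
    simp only [mul_assoc, ← Finset.mul_sum, ih]
    rw [pow_succ, mul_assoc, ← hB, Finset.mul_sum]
    exact Finset.sum_congr rfl fun k _ => by ring

/-- Some positive power of a square matrix of natural numbers has a transitive pattern of positive
entries. -/
theorem Matrix.exists_pow_transitive (A : Matrix V V ℕ) :
    ∃ d, 0 < d ∧ ∀ j k l, 0 < (A ^ d) j k → 0 < (A ^ d) k l → 0 < (A ^ d) j l := by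
  let R : ℕ → V → V → Prop := fun n j k => 0 < (A ^ n) j k
  -- There are finitely many zero patterns, and the pattern of a product depends only on those of
  -- its factors, so the patterns of the powers are eventually periodic.
  obtain ⟨a, b, hab, hR⟩ : ∃ a b, a < b ∧ R a = R b := by
    obtain ⟨a, b, hne, hR⟩ := Finite.exists_ne_map_eq_of_infinite R
    rcases hne.lt_or_gt with h | h
    · exact ⟨a, b, h, hR⟩
    · exact ⟨b, a, h, hR.symm⟩
  have hstep : ∀ n n', R n = R n' → ∀ t, R (n + t) = R (n' + t) := by
    intro n n' h t
    funext j l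
    simp only [R, pow_add, Matrix.nat_mul_apply_pos_iff]
    exact propext (exists_congr fun k => by rw [show (0 < (A ^ n) j k) = _ from congrFun₂ h j k])
  have hper : ∀ n, a ≤ n → ∀ i, R (n + (b - a) * i) = R n := by
    intro n hn i
    induction i with
    | zero => simp
    | succ i ih =>
      have h1 := hstep a b hR (n + (b - a) * i - a)
      rw [show a + (n + (b - a) * i - a) = n + (b - a) * i by omega,
        show b + (n + (b - a) * i - a) = n + (b - a) * (i + 1) by rw [mul_add]; omega, ih] at h1
      exact h1.symm
  have hd : a ≤ (b - a) * (a + 1) := by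
    calc a ≤ 1 * (a + 1) := by omega
      _ ≤ _ := Nat.mul_le_mul_right _ (by omega)
  -- This exponent is a multiple of the period `b - a` and at least the preperiod `a`, so `A ^ d`
  -- and `A ^ (2 * d)` have the same pattern.
  refine ⟨(b - a) * (a + 1), Nat.mul_pos (by omega) (by omega), fun j k l h1 h2 => ?_⟩
  have h := congrFun₂ (hper _ hd (a + 1)) j l
  simp only [R] at h
  rw [← h, pow_add, Matrix.nat_mul_apply_pos_iff]
  exact ⟨k, h1, h2⟩

theorem Matrix.pow_apply_eq_zero_of_closed {B : Matrix V V ℕ} {T : Finset V}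
    (hT : ∀ j ∈ T, ∀ k, 0 < B j k → k ∈ T) (N : ℕ) {j k : V} (hj : j ∈ T) (hk : k ∉ T) :
    (B ^ N) j k = 0 := by
  induction N generalizing j with
  | zero =>
    rw [pow_zero, Matrix.one_apply_ne]
    rintro rfl
    exact hk hj
  | succ N ih =>
    rw [pow_succ', Matrix.mul_apply]
    refine Finset.sum_eq_zero fun l _ => ?_
    rcases Nat.eq_zero_or_pos (B j l) with h | h
    · rw [h, zero_mul]
    · rw [ih (hT j hj l h), mul_zero]

/-- Let `T` be a closed class of indices on which `B` is positive, and let `v` be a positive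
eigenvector. For large `N`, each row of `B ^ N` in `T` is a sum of rows of equal weight `W`. -/
theorem Matrix.exists_equal_weight_rows (B : Matrix V V ℕ) (v : V → ℕ) (hv : ∀ j, 0 < v j)
    {Q : ℕ} (hQ : 2 ≤ Q) (hB : ∀ j, ∑ k, B j k * v k = Q * v j) (T : Finset V)
    (hT : ∀ j ∈ T, ∀ k, 0 < B j k ↔ k ∈ T) :
    ∃ W, 0 < W ∧ ∃ N₀, ∀ N, N₀ ≤ N → ∀ j ∈ T, ∃ q, 0 < q ∧ q * W = Q ^ N * v j ∧
      ∃ a : Fin q → V → ℕ, (∀ k, ∑ i, a i k = (B ^ N) j k) ∧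
        (∀ i, ∑ k, a i k * v k = W) ∧ ∀ i k, a i k ≠ 0 → k ∈ T := by
  classical
  rcases T.eq_empty_or_nonempty with rfl | ⟨j₀, hj₀⟩
  · exact ⟨1, one_pos, 0, by simp⟩
  obtain ⟨g, hg, hgv, c, hc⟩ := exists_bezout T v ⟨j₀, hj₀, hv j₀⟩
  set S := ∑ l ∈ T, v l with hS
  have hvS : ∀ l ∈ T, v l ≤ S := fun l hl => Finset.single_le_sum (f := v) (by simp) hl
  have hS0 : 0 < S := (hv j₀).trans_le (hvS j₀ hj₀)
  let R := ∑ k ∈ T, (c k).natAbs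
  have hcR : ∀ k ∈ T, (c k).natAbs ≤ R := fun k hk =>
    Finset.single_le_sum (f := fun k => (c k).natAbs) (by simp) hk
  -- Chosen so that `e < Q ^ e`: groups of weight `g * Q ^ e` are heavy enough for each kind to
  -- supply the Bézout corrections. Neither `e` nor the weight depends on `N` or on the row.
  let e := S * Q * (R * S)
  have hclosed : ∀ j ∈ T, ∀ k, 0 < B j k → k ∈ T := fun j hj k h => (hT j hj k).1 h
  have hsumT : ∀ N, ∀ j ∈ T, ∑ k ∈ T, (B ^ N) j k * v k = Q ^ N * v j := by
    intro N j hj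
    rw [← Matrix.pow_mul_weight B v Q hB N j]
    refine Finset.sum_subset (Finset.subset_univ _) fun k _ hk => ?_
    rw [Matrix.pow_apply_eq_zero_of_closed hclosed N hj hk, zero_mul]
  -- Every type in `T` yields each type `k ∈ T` in one further step, so each entry is at least the
  -- whole row sum of `B ^ N`.
  have hgrowth : ∀ N, ∀ j ∈ T, ∀ k ∈ T, Q ^ N * v j ≤ S * (B ^ (N + 1)) j k := by
    intro N j hj k hk
    rw [← hsumT N j hj, pow_succ, Matrix.mul_apply, Finset.mul_sum]
    calc ∑ l ∈ T, (B ^ N) j l * v l ≤ ∑ l ∈ T, S * ((B ^ N) j l * B l k) := by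
          refine Finset.sum_le_sum fun l hl => ?_
          have h1 : 1 ≤ B l k := (hT l hl k).2 hk
          calc (B ^ N) j l * v l ≤ (B ^ N) j l * S := Nat.mul_le_mul_left _ (hvS l hl)
            _ = S * ((B ^ N) j l * 1) := by ring
            _ ≤ _ := by gcongr
      _ ≤ _ := Finset.sum_le_sum_of_subset (Finset.subset_univ _)
  have hQ0 : 0 < Q := by omega
  refine ⟨g * Q ^ e, by positivity, e + 1, fun N hN j hj => ?_⟩
  obtain ⟨N, rfl⟩ : ∃ n, N = n + 1 := ⟨N - 1, by omega⟩
  obtain ⟨t, ht⟩ := hgv j hj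
  have ht0 : 0 < t := by
    rcases Nat.eq_zero_or_pos t with rfl | h
    · have := hv j
      omega
    · exact h
  have hq : t * Q ^ (N + 1 - e) * (g * Q ^ e) = Q ^ (N + 1) * v j := by
    rw [ht]
    calc _ = Q ^ (N + 1 - e) * Q ^ e * (g * t) := by ring
      _ = _ := by rw [← pow_add, Nat.sub_add_cancel (by omega)]
  refine ⟨t * Q ^ (N + 1 - e), by positivity, hq, ?_⟩
  set q := t * Q ^ (N + 1 - e)
  obtain ⟨a, ha1, ha2⟩ := exists_equal_weight_partition T v hg hgv c hc
    (fun k => (B ^ (N + 1)) j k) (q := q) (W := g * Q ^ e) (by positivity)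
    (by rw [hsumT _ j hj, hq]) (dvd_mul_right _ _) (by
      intro k hk
      have h1 : S * Q * ((c k).natAbs * S) ≤ g * Q ^ e := by
        calc S * Q * ((c k).natAbs * S) ≤ S * Q * (R * S) := by gcongr; exact hcR k hk
          _ ≤ Q ^ e := (Nat.lt_pow_self (by omega)).le
          _ ≤ g * Q ^ e := Nat.le_mul_of_pos_left _ hg
      refine Nat.le_of_mul_le_mul_left ?_ (Nat.mul_pos hS0 hQ0)
      calc S * Q * ((c k).natAbs * S * q) = q * (S * Q * ((c k).natAbs * S)) := by ring
        _ ≤ q * (g * Q ^ e) := by gcongr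
        _ = Q * (Q ^ N * v j) := by rw [hq, pow_succ]; ring
        _ ≤ Q * (S * (B ^ (N + 1)) j k) := Nat.mul_le_mul_left _ (hgrowth N j hj k hk)
        _ = _ := by ring)
  refine ⟨fun i k => if k ∈ T then a i k else 0, fun k => ?_, fun i => ?_, fun i k hk => ?_⟩
  · by_cases hk : k ∈ T
    · simp [hk, ha1 k hk]
    · simp [hk, Matrix.pow_apply_eq_zero_of_closed hclosed _ hj hk]
  · rw [← ha2 i]
    simp [ite_mul, Finset.sum_ite_mem]
  · by_contra h
    simp [h] at hk

/-- If every index leads in one step to the closed set `F`, the rows of `B ^ N` have eventually less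
than `Q ^ N` outside `F`. -/
theorem Matrix.sum_pow_compl_lt (B : Matrix V V ℕ) (v : V → ℕ) (hv : ∀ j, 0 < v j)
    {Q : ℕ} (hQ : 2 ≤ Q) (hB : ∀ j, ∑ k, B j k * v k = Q * v j) (F : Finset V)
    (hF : ∀ j ∈ F, ∀ k, 0 < B j k → k ∈ F) (hreach : ∀ j, ∃ k ∈ F, 0 < B j k) :
    ∃ N₀, ∀ N, N₀ ≤ N → ∀ j, ∑ k ∈ Fᶜ, (B ^ N) j k < Q ^ N := by
  classical
  rcases isEmpty_or_nonempty V with hV | ⟨⟨j₀⟩⟩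
  · exact ⟨0, fun N _ j => hV.elim j⟩
  set S := ∑ l, v l with hS
  have hvS : ∀ l, v l ≤ S := fun l => Finset.single_le_sum (f := v) (by simp) (Finset.mem_univ l)
  have hS0 : 0 < S := (hv j₀).trans_le (hvS j₀)
  have hS1 : (1 : ℝ) ≤ S := by exact_mod_cast hS0
  have hQ2 : (2 : ℝ) ≤ Q := by exact_mod_cast hQ
  -- At each step from `j` weight at least `1`, hence at least `v j / S`, is lost to `F`, and it
  -- never returns as `F` is closed. The weight outside `F` thus grows at a rate at most `θ < Q`.
  let θ : ℝ := Q - 1 / S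
  have hθ0 : 0 < θ := by
    have : 1 / (S : ℝ) ≤ 1 := (div_le_one (by positivity)).2 hS1
    simp only [θ]
    linarith
  have hθQ : θ < Q := by
    have : 0 < 1 / (S : ℝ) := by positivity
    simp only [θ]
    linarith
  let u : ℕ → V → ℕ := fun N j => ∑ k ∈ Fᶜ, (B ^ N) j k * v k
  have hstep : ∀ j, ((∑ l ∈ Fᶜ, B j l * v l : ℕ) : ℝ) ≤ θ * v j := by
    intro j
    obtain ⟨k, hkF, hk⟩ := hreach j
    have h1 : 1 + ∑ l ∈ Fᶜ, B j l * v l ≤ Q * v j := by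
      rw [← hB j, ← Finset.sum_add_sum_compl F]
      gcongr
      calc 1 ≤ B j k * v k := Nat.mul_pos hk (hv k)
        _ ≤ _ := Finset.single_le_sum (f := fun k => B j k * v k) (by simp) hkF
    have h2 : (1 : ℝ) + ((∑ l ∈ Fᶜ, B j l * v l : ℕ) : ℝ) ≤ Q * v j := by exact_mod_cast h1
    have h3 : 1 / (S : ℝ) * v j ≤ 1 := by
      rw [one_div, inv_mul_le_iff₀ (by positivity), mul_one]
      exact_mod_cast hvS j
    simp only [θ, sub_mul]
    linarith
  have hu0 : ∀ N, ∀ j ∈ F, u N j = 0 := fun N j hj => Finset.sum_eq_zero fun k hk => by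
    rw [Matrix.pow_apply_eq_zero_of_closed hF N hj (Finset.mem_compl.1 hk), zero_mul]
  have husucc : ∀ N j, u (N + 1) j = ∑ l ∈ Fᶜ, B j l * u N l := by
    intro N j
    have h : u (N + 1) j = ∑ l, B j l * u N l := by
      simp only [u, pow_succ' B, Matrix.mul_apply, Finset.sum_mul, Finset.mul_sum]
      rw [Finset.sum_comm]
      simp only [mul_assoc]
    rw [h, ← Finset.sum_add_sum_compl F, Finset.sum_eq_zero fun l hl => by rw [hu0 N l hl, mul_zero],
      zero_add]
  have hu : ∀ N j, (u N j : ℝ) ≤ θ ^ N * v j := by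
    intro N
    induction N with
    | zero =>
      intro j
      have h : u 0 j ≤ v j := by
        have := Matrix.pow_mul_weight B v Q hB 0 j
        rw [pow_zero, pow_zero, one_mul] at this
        simp only [u, pow_zero]
        conv_rhs => rw [← this]
        exact Finset.sum_le_sum_of_subset (Finset.subset_univ _)
      simpa using h
    | succ N ih =>
      intro j
      calc (u (N + 1) j : ℝ) = ∑ l ∈ Fᶜ, (B j l : ℝ) * u N l := by rw [husucc]; push_cast; rfl
        _ ≤ ∑ l ∈ Fᶜ, (B j l : ℝ) * (θ ^ N * v l) := by gcongr; exact ih _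
        _ = θ ^ N * ((∑ l ∈ Fᶜ, B j l * v l : ℕ) : ℝ) := by
          push_cast
          rw [Finset.mul_sum]
          exact Finset.sum_congr rfl fun l _ => by ring
        _ ≤ θ ^ N * (θ * v j) := by gcongr; exact hstep j
        _ = _ := by ring
  have hlim : Filter.Tendsto (fun N : ℕ => (θ / Q) ^ N * S) Filter.atTop (nhds 0) := by
    simpa using (tendsto_pow_atTop_nhds_zero_of_lt_one (by positivity)
      ((div_lt_one (by positivity)).2 hθQ)).mul_const (S : ℝ)
  obtain ⟨N₀, hN₀⟩ := Filter.eventually_atTop.1 (hlim.eventually (gt_mem_nhds one_pos))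
  refine ⟨N₀, fun N hN j => ?_⟩
  have h1 : ∑ k ∈ Fᶜ, (B ^ N) j k ≤ u N j :=
    Finset.sum_le_sum fun k _ => Nat.le_mul_of_pos_right _ (hv k)
  have h2 := hN₀ N hN
  rw [div_pow, div_mul_eq_mul_div, div_lt_one (by positivity)] at h2
  have h3 : ((∑ k ∈ Fᶜ, (B ^ N) j k : ℕ) : ℝ) < (Q : ℝ) ^ N := by
    calc ((∑ k ∈ Fᶜ, (B ^ N) j k : ℕ) : ℝ) ≤ u N j := by exact_mod_cast h1
      _ ≤ θ ^ N * v j := hu N j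
      _ ≤ θ ^ N * S := by gcongr; exact hvS j
      _ < _ := h2
  exact_mod_cast h3

/-- For a matrix `A` of natural numbers with a positive eigenvector of eigenvalue `m`, there are a
power `A ^ L` and a set `𝒯` of classes of indices, such that the rows of `A ^ L` in a class are sums
of rows of equal weight in this class, and each row meets a class and has less than `m ^ L` outside
the classes. -/
theorem Matrix.exists_pow_equal_weight_rows (A : Matrix V V ℕ) (v : V → ℕ) (hv : ∀ j, 0 < v j)
    {m : ℕ} (hm : 2 ≤ m) (hA : ∀ j, ∑ k, A j k * v k = m * v j) :
    ∃ L, 0 < L ∧ ∃ (𝒯 : Finset (Finset V)) (W : Finset V → ℕ),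
      (∀ T ∈ 𝒯, 0 < W T ∧ ∀ j ∈ T, ∃ q, 0 < q ∧ q * W T = m ^ L * v j ∧
        ∃ a : Fin q → V → ℕ, (∀ k, ∑ i, a i k = (A ^ L) j k) ∧
          (∀ i, ∑ k, a i k * v k = W T) ∧ ∀ i k, a i k ≠ 0 → k ∈ T) ∧
      ∀ j, (∃ T ∈ 𝒯, ∃ k ∈ T, 0 < (A ^ L) j k) ∧ ∑ k ∈ (𝒯.sup id)ᶜ, (A ^ L) j k < m ^ L := by
  classical
  obtain ⟨d, hd, htrans⟩ := A.exists_pow_transitive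
  set B := A ^ d with hBdef
  have hB : ∀ j, ∑ k, B j k * v k = m ^ d * v j := A.pow_mul_weight v m hA d
  have hQ : 2 ≤ m ^ d := hm.trans (Nat.le_self_pow hd.ne' m)
  let 𝒯 : Finset (Finset V) := Finset.univ.filter fun T => ∀ j ∈ T, ∀ k, 0 < B j k ↔ k ∈ T
  have h𝒯 : ∀ T, T ∈ 𝒯 ↔ ∀ j ∈ T, ∀ k, 0 < B j k ↔ k ∈ T := fun T => by simp [𝒯]
  have hreach : ∀ j, ∃ T ∈ 𝒯, ∃ k ∈ T, 0 < B j k := by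
    intro j
    let N : V → Finset V := fun j => Finset.univ.filter fun k => 0 < B j k
    have hN : ∀ j k, k ∈ N j ↔ 0 < B j k := fun j k => by simp [N]
    have hne : ∀ j, (N j).Nonempty := by
      intro j
      by_contra h
      rw [Finset.not_nonempty_iff_eq_empty] at h
      have h0 : ∑ k, B j k * v k = 0 := Finset.sum_eq_zero fun k _ => by
        have : k ∉ N j := by simp [h]
        rw [hN, Nat.pos_iff_ne_zero, not_not] at this
        rw [this, zero_mul]
      rw [hB] at h0
      have := Nat.mul_pos (by omega : 0 < m ^ d) (hv j)
      omega
    have hsub : ∀ j k, k ∈ N j → N k ⊆ N j := fun j k hk l hl =>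
      (hN j l).2 (htrans j k l ((hN j k).1 hk) ((hN k l).1 hl))
    -- By transitivity the sets `N i` shrink along edges; where the cardinality is minimal they are
    -- constant, so `N k` is a class.
    obtain ⟨k, hk, hmin⟩ := Finset.exists_min_image (N j) (fun k => (N k).card) (hne j)
    obtain ⟨l, hl⟩ := hne k
    refine ⟨N k, (h𝒯 _).2 fun i hi n => ?_, l, hl, (hN j l).1 (hsub j k hk hl)⟩
    rw [← hN, Finset.eq_of_subset_of_card_le (hsub k i hi) (hmin i (hsub j k hk hi))]
  have hsup : ∀ k, k ∈ 𝒯.sup id ↔ ∃ T ∈ 𝒯, k ∈ T := fun k => by simp [Finset.mem_sup]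
  obtain ⟨N₁, hN₁⟩ := Matrix.sum_pow_compl_lt B v hv hQ hB (𝒯.sup id)
    (by
      intro j hj k hk
      obtain ⟨T, hT, hjT⟩ := (hsup j).1 hj
      exact (hsup k).2 ⟨T, hT, ((h𝒯 T).1 hT j hjT k).1 hk⟩)
    (by
      intro j
      obtain ⟨T, hT, k, hkT, hk⟩ := hreach j
      exact ⟨k, (hsup k).2 ⟨T, hT, hkT⟩, hk⟩)
  have hrows : ∀ T, ∃ W N₀, T ∈ 𝒯 → 0 < W ∧ ∀ N, N₀ ≤ N → ∀ j ∈ T, ∃ q, 0 < q ∧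
      q * W = (m ^ d) ^ N * v j ∧ ∃ a : Fin q → V → ℕ, (∀ k, ∑ i, a i k = (B ^ N) j k) ∧
        (∀ i, ∑ k, a i k * v k = W) ∧ ∀ i k, a i k ≠ 0 → k ∈ T := by
    intro T
    by_cases hT : T ∈ 𝒯
    · obtain ⟨W, hW, N₀, h⟩ := Matrix.exists_equal_weight_rows B v hv hQ hB T ((h𝒯 T).1 hT)
      exact ⟨W, N₀, fun _ => ⟨hW, h⟩⟩
    · exact ⟨0, 0, fun h => absurd h hT⟩
  choose W N₀ hW using hrows
  -- One exponent for all classes; the `+ 1` makes it positive, so that each index reaches a class.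
  let N := max N₁ (𝒯.sup N₀) + 1
  refine ⟨d * N, Nat.mul_pos hd (by omega), 𝒯, W, fun T hT => ⟨(hW T hT).1, ?_⟩, fun j => ⟨?_, ?_⟩⟩
  · rw [pow_mul A, pow_mul m]
    refine (hW T hT).2 N ?_
    have : N₀ T ≤ 𝒯.sup N₀ := Finset.le_sup hT
    simp only [N]
    omega
  · obtain ⟨T, hT, k, hkT, hk⟩ := hreach j
    refine ⟨T, hT, k, hkT, ?_⟩
    rw [pow_mul A]
    simp only [N]
    induction max N₁ (𝒯.sup N₀) with
    | zero => simpa using hk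
    | succ n ih =>
      rw [pow_succ, Matrix.nat_mul_apply_pos_iff]
      exact ⟨k, ih, ((h𝒯 T).1 hT k hkT k).2 hkT⟩
  · rw [pow_mul A, pow_mul m]
    exact hN₁ N (by simp only [N]; omega) j

end NonnegativeMatrix

/-! ### Expansion of cells and regrouping of subcells. -/

/-- Relabelling of a finite type `ι` coloured by `t` with `n k` elements of colour `k`. -/
theorem exists_equiv_sigma_fin {V ι : Type*} [DecidableEq V] [Fintype ι] (t : ι → V) (n : V → ℕ)
    (h : ∀ k, ∑ i, (if t i = k then 1 else 0) = n k) :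
    ∃ e : (Σ k, Fin (n k)) ≃ ι, ∀ x, t (e x) = x.1 := by
  have hcard : ∀ k, Fintype.card {i // t i = k} = n k := fun k => by
    rw [Fintype.card_subtype, Finset.card_filter, h]
  let e : ι ≃ Σ k, Fin (n k) := (Equiv.sigmaFiberEquiv t).symm.trans
    (Equiv.sigmaCongrRight fun k => Fintype.equivFinOfCardEq (hcard k))
  refine ⟨e.symm, fun x => ?_⟩
  obtain ⟨i, rfl⟩ := e.surjective x
  rw [Equiv.symm_apply_apply]
  rfl

theorem sum_sigma_fin {V : Type*} [Fintype V] (n p : V → ℕ) :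
    ∑ x : Σ k, Fin (n k), p x.1 = ∑ k, n k * p k := by
  rw [Fintype.sum_sigma]
  simp

theorem sum_sigma_fin_ite {V : Type*} [Fintype V] [DecidableEq V] (n : V → ℕ) (k : V) :
    ∑ x : Σ k, Fin (n k), (if x.1 = k then 1 else 0) = n k := by
  rw [sum_sigma_fin n fun l => if l = k then 1 else 0]
  simp

section Expansion

universe u

variable {V : Type u} {X : Type*} [MetricSpace X]

/-- Each cell of type `j` and scale `s` is the union of cells of scale `ρ * s`, of which `B j k` have
type `k`, and whose mutual distances are at least `s / C`. -/
def Expands (Cell : V → ℝ → Set X → Prop) (B : Matrix V V ℕ) (ρ C : ℝ) : Prop :=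
  ∀ j s U, 0 < s → Cell j s U → ∃ S : (Σ k, Fin (B j k)) → Set X, U = ⋃ x, S x ∧
    (∀ x, Cell x.1 (ρ * s) (S x)) ∧ ∀ x y, x ≠ y → ∀ a ∈ S x, ∀ b ∈ S y, s ≤ C * dist a b

variable {Cell : V → ℝ → Set X → Prop} {B B' : Matrix V V ℕ} {ρ ρ' C C' : ℝ}

theorem Expands.mono (h : Expands Cell B ρ C) (hC : C ≤ C') : Expands Cell B ρ C' := by
  intro j s U hs hU
  obtain ⟨S, hS, hcell, hsep⟩ := h j s U hs hU
  exact ⟨S, hS, hcell, fun x y hxy a ha b hb => (hsep x y hxy a ha b hb).trans (by gcongr)⟩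

/-- Subcells of different children are separated like the children, those of one child at the
smaller scale `ρ * s`; hence the `C' / ρ`. -/
theorem Expands.mul [Fintype V] [DecidableEq V] (hρ : 0 < ρ) (h : Expands Cell B ρ C)
    (h' : Expands Cell B' ρ' C') : Expands Cell (B * B') (ρ * ρ') (max C (C' / ρ)) := by
  intro j s U hs hU
  obtain ⟨S, hS, hcell, hsep⟩ := h j s U hs hU
  choose S' hS' hcell' hsep' using fun x => h' x.1 (ρ * s) (S x) (by positivity) (hcell x)
  obtain ⟨e, he⟩ := exists_equiv_sigma_fin
    (fun i : Σ x : (Σ k, Fin (B j k)), Σ l, Fin (B' x.1 l) => i.2.1) (fun l => (B * B') j l)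
    (fun l => by
      rw [Fintype.sum_sigma, Matrix.mul_apply, ← sum_sigma_fin]
      exact Finset.sum_congr rfl fun x _ => sum_sigma_fin_ite _ l)
  refine ⟨fun x => S' (e x).1 (e x).2, ?_, fun x => ?_, fun x y hxy => ?_⟩
  · rw [e.surjective.iUnion_comp (fun i => S' i.1 i.2), hS]
    exact (Set.iUnion_congr hS').trans (Set.iUnion_sigma
      fun i : (Σ x : (Σ k, Fin (B j k)), Σ l, Fin (B' x.1 l)) => S' i.1 i.2).symm
  · have := hcell' (e x).1 (e x).2
    rwa [he, ← mul_assoc, mul_comm ρ' ρ] at this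
  · have hne : e x ≠ e y := e.injective.ne hxy
    change ∀ a ∈ S' (e x).1 (e x).2, ∀ b ∈ S' (e y).1 (e y).2, _
    generalize e x = p at hne ⊢
    generalize e y = q at hne ⊢
    obtain ⟨p, p'⟩ := p
    obtain ⟨q, q'⟩ := q
    intro a ha b hb
    by_cases hpq : p = q
    · subst hpq
      have h1 := hsep' p p' q' (fun h => hne (by rw [h])) a ha b hb
      calc s = ρ * s / ρ := by field_simp
        _ ≤ C' * dist a b / ρ := by gcongr
        _ = C' / ρ * dist a b := by ring
        _ ≤ _ := by gcongr; exact le_max_right _ _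
    · have hsub : ∀ p p', S' p p' ⊆ S p := fun p p' => by
        rw [hS' p]
        exact Set.subset_iUnion (S' p) p'
      exact (hsep p q hpq a (hsub _ _ ha) b (hsub _ _ hb)).trans (by gcongr; exact le_max_left _ _)

theorem Expands.pow [Fintype V] [DecidableEq V] (hρ : 0 < ρ) (h : Expands Cell B ρ C) {n : ℕ}
    (hn : 1 ≤ n) : ∃ C', Expands Cell (B ^ n) (ρ ^ n) C' := by
  induction n, hn using Nat.le_induction with
  | base => exact ⟨C, by simpa using h⟩
  | succ n _ ih =>
    obtain ⟨C', h'⟩ := ih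
    rw [pow_succ, pow_succ]
    exact ⟨_, h'.mul (by positivity) h⟩

/-- A union of separated cells of scale `s`, with types in `T` and of total weight `W`. -/
def IsCellGroup (Cell : V → ℝ → Set X → Prop) (v : V → ℕ) (T : Finset V) (W : ℕ) (C s : ℝ)
    (U : Set X) : Prop :=
  0 < s ∧ ∃ (ι : Type u) (_ : Fintype ι) (t : ι → V) (S : ι → Set X), U = ⋃ i, S i ∧
    (∀ i, t i ∈ T) ∧ (∀ i, Cell (t i) s (S i)) ∧
    (∀ i j, i ≠ j → ∀ x ∈ S i, ∀ y ∈ S j, s ≤ C * dist x y) ∧ ∑ i, v (t i) = W ∧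
    ∀ x ∈ U, ∀ y ∈ U, dist x y ≤ C * s

variable [Fintype V] [DecidableEq V] {v : V → ℕ} {T : Finset V} {W M : ℕ} {s : ℝ} {U : Set X}

/-- Carries a numerical partition of row `j` over to the subcells of a cell of type `j`. -/
theorem Expands.exists_groups (h : Expands Cell B ρ C) (hρ : 0 < ρ) (hρ1 : ρ ≤ 1)
    {j : V} (hs : 0 < s) (hU : Cell j s U) (hd : ∀ x ∈ U, ∀ y ∈ U, dist x y ≤ C * (ρ * s))
    {q : ℕ} (a : Fin q → V → ℕ) (ha : ∀ k, ∑ i, a i k = B j k)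
    (haW : ∀ i, ∑ k, a i k * v k = W) (haT : ∀ i k, a i k ≠ 0 → k ∈ T) :
    ∃ P : Fin q → Set X, U = ⋃ i, P i ∧
      (∀ i, IsCellGroup Cell v T W C (ρ * s) (P i)) ∧
      ∀ i i', i ≠ i' → ∀ x ∈ P i, ∀ y ∈ P i', s ≤ C * dist x y := by
  obtain ⟨S, hS, hcell, hsep⟩ := h j s U hs hU
  obtain ⟨e, he⟩ := exists_equiv_sigma_fin
    (fun p : Σ i : Fin q, Σ k, Fin (a i k) => p.2.1) (fun k => B j k)
    (fun k => by
      rw [Fintype.sum_sigma, ← ha]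
      exact Finset.sum_congr rfl fun i _ => sum_sigma_fin_ite _ k)
  have he' : ∀ p, (e.symm p).1 = p.2.1 := fun p => by rw [← he, Equiv.apply_symm_apply]
  have hsub : ∀ x, S x ⊆ U := fun x => hS ▸ Set.subset_iUnion S x
  refine ⟨fun i => ⋃ p : Σ k, Fin (a i k), S (e.symm ⟨i, p⟩), ?_, fun i => ?_, ?_⟩
  · rw [hS, ← Set.iUnion_sigma (fun p => S (e.symm p)), e.symm.surjective.iUnion_comp S]
  · refine ⟨by positivity, (Σ k, Fin (a i k)), inferInstance, fun p => p.1,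
      fun p => S (e.symm ⟨i, p⟩), rfl, fun p => ?_,
      fun p => ?_, fun p p' hp x hx y hy => ?_, ?_, fun x hx y hy => ?_⟩
    · exact haT i p.1 (Fin.pos p.2).ne'
    · have := hcell (e.symm ⟨i, p⟩)
      rwa [he'] at this
    · exact (mul_le_of_le_one_left hs.le hρ1).trans
        (hsep _ _ (e.symm.injective.ne (by simpa using hp)) x hx y hy)
    · rw [← haW i]
      exact sum_sigma_fin (a i) v
    · exact hd x (Set.iUnion_subset (fun p => hsub _) hx) y (Set.iUnion_subset (fun p => hsub _) hy)
  · intro i i' hi x hx y hy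
    obtain ⟨p, hx⟩ := Set.mem_iUnion.1 hx
    obtain ⟨p', hy⟩ := Set.mem_iUnion.1 hy
    exact hsep _ _ (e.symm.injective.ne fun h => hi (congrArg Sigma.fst h)) x hx y hy

/-- Groups of weight `W` reproduce themselves: a member of type `k` yields `M * v k / W` new groups,
and the sum over a group of weight `W` is exactly `M`. -/
theorem IsCellGroup.treeLike (h : Expands Cell B ρ C) (hρ : 0 < ρ) (hρ1 : ρ ≤ 1) (hW : 0 < W)
    (hcell : ∀ j s U, 0 < s → Cell j s U → U.Nonempty ∧ IsCompact U ∧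
      ∀ x ∈ U, ∀ y ∈ U, dist x y ≤ C * (ρ * s))
    (hT : ∀ j ∈ T, ∃ q, 0 < q ∧ q * W = M * v j ∧
        ∃ a : Fin q → V → ℕ, (∀ k, ∑ i, a i k = B j k) ∧
          (∀ i, ∑ k, a i k * v k = W) ∧ ∀ i k, a i k ≠ 0 → k ∈ T)
    (hU : IsCellGroup Cell v T W C s U) : TreeLike M ρ C s U := by
  refine ⟨IsCellGroup Cell v T W C, ?_, hU⟩
  clear hU
  rintro s U ⟨hs, ι, _, t, S, hU, htT, hS, hsep, hweight, hd⟩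
  choose q hq hqW a ha haW haT using fun i => hT (t i) (htT i)
  choose P hPU hP hPsep using fun i => h.exists_groups hρ hρ1 hs (hS i)
    (hcell _ _ _ hs (hS i)).2.2 (a i) (ha i) (haW i) (haT i)
  have hcard : Fintype.card (Σ i, Fin (q i)) = M := by
    refine Nat.eq_of_mul_eq_mul_right hW ?_
    simp only [Fintype.card_sigma, Fintype.card_fin, Finset.sum_mul, hqW, ← Finset.mul_sum, hweight]
  have hne : U.Nonempty := by
    obtain ⟨i, -, -⟩ := Finset.exists_ne_zero_of_sum_ne_zero (by rw [hweight]; exact hW.ne')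
    exact (hcell _ _ _ hs (hS i)).1.mono (hU ▸ Set.subset_iUnion S i)
  have hc : IsCompact U := by
    rw [hU]
    exact isCompact_iUnion fun i => (hcell _ _ _ hs (hS i)).2.1
  refine Splits.of_fintype hcard hs hne hc hd (fun p => P p.1 p.2) ?_ ?_ fun p => hP p.1 p.2
  · rw [hU]
    exact (Set.iUnion_congr hPU).trans (Set.iUnion_sigma
      fun p : (Σ i, Fin (q i)) => P p.1 p.2).symm
  · rintro ⟨i, p⟩ ⟨i', p'⟩ hp x hx y hy
    by_cases hi : i = i'
    · subst hi
      exact hPsep i p p' (fun h => hp (by rw [h])) x hx y hy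
    · have hsub : ∀ i p, P i p ⊆ S i := fun i p => by
        rw [hPU i]
        exact Set.subset_iUnion (P i) p
      exact hsep i i' hi x (hsub _ _ hx) y (hsub _ _ hy)

/-- Such a cell is a union of tree-like groups of the next scale, in number at most `M * ∑ k, v k`.
-/
theorem Expands.treeLike_of_mem_class (h : Expands Cell B ρ C) (hM : 2 ≤ M) (hρ : 0 < ρ)
    (hρ1 : ρ ≤ 1) (hC : 0 < C) (hW : 0 < W)
    (hcell : ∀ j s U, 0 < s → Cell j s U → U.Nonempty ∧ IsCompact U ∧
      ∀ x ∈ U, ∀ y ∈ U, dist x y ≤ C * (ρ * s))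
    (hT : ∀ j ∈ T, ∃ q, 0 < q ∧ q * W = M * v j ∧
        ∃ a : Fin q → V → ℕ, (∀ k, ∑ i, a i k = B j k) ∧
          (∀ i, ∑ k, a i k * v k = W) ∧ ∀ i k, a i k ≠ 0 → k ∈ T)
    {j : V} (hj : j ∈ T) (hs : 0 < s) (hU : Cell j s U) :
    TreeLike M ρ (C / ρ ^ (M * ∑ k, v k) / ρ) s U := by
  obtain ⟨q, hq, hqW, a, ha, haW, haT⟩ := hT j hj
  obtain ⟨P, rfl, hP, hPsep⟩ := h.exists_groups hρ hρ1 hs hU (hcell _ _ _ hs hU).2.2 a ha haW haT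
  have : NeZero q := ⟨hq.ne'⟩
  refine TreeLike.coarsen ?_ hρ hρ1 (by positivity)
  refine TreeLike.iUnion_fintype hM hρ hρ1 hC ?_ P
    (fun i => (hP i).treeLike h hρ hρ1 hW hcell hT)
    (fun i i' hi x hx y hy => (mul_le_of_le_one_left hs.le hρ1).trans (hPsep i i' hi x hx y hy))
    (hcell _ _ _ hs hU).2.2
  rw [Fintype.card_fin]
  calc q ≤ q * W := Nat.le_mul_of_pos_right _ hW
    _ = M * v j := hqW
    _ ≤ _ := Nat.mul_le_mul_left _ (Finset.single_le_sum (f := v) (by simp) (Finset.mem_univ j))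

/-- All cells are split by regular `M`-ary trees, if each cell contains cells with types in the classes
`T ∈ 𝒯` and less than `M` other cells. -/
theorem Expands.treeLike (h : Expands Cell B ρ C) (hM : 2 ≤ M) (hρ : 0 < ρ)
    (hρ1 : ρ ≤ 1) (hC : 0 < C)
    (hcell : ∀ j s U, 0 < s → Cell j s U → U.Nonempty ∧ IsCompact U ∧
      ∀ x ∈ U, ∀ y ∈ U, dist x y ≤ C * (ρ * s))
    (hv : ∀ j, 0 < v j) (hB : ∀ j, ∑ k, B j k * v k = M * v j)
    (𝒯 : Finset (Finset V)) (W : Finset V → ℕ)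
    (h𝒯 : ∀ T ∈ 𝒯, 0 < W T ∧ ∀ j ∈ T, ∃ q, 0 < q ∧ q * W T = M * v j ∧
        ∃ a : Fin q → V → ℕ, (∀ k, ∑ i, a i k = B j k) ∧
          (∀ i, ∑ k, a i k * v k = W T) ∧ ∀ i k, a i k ≠ 0 → k ∈ T)
    (hreach : ∀ j, (∃ T ∈ 𝒯, ∃ k ∈ T, 0 < B j k) ∧ ∑ k ∈ (𝒯.sup id)ᶜ, B j k < M) :
    ∃ C', 0 < C' ∧ ∀ j s U, 0 < s → Cell j s U → TreeLike M ρ C' s U := by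
  set F := 𝒯.sup id with hF
  have hsup : ∀ k, k ∈ F ↔ ∃ T ∈ 𝒯, k ∈ T := fun k => by simp [hF, Finset.mem_sup]
  set n := M * ∑ k, v k with hn
  set C₁ := C / ρ ^ n / ρ with hC₁
  set C₂ := C₁ / ρ ^ n with hC₂
  have hC₁0 : 0 < C₁ := by positivity
  have hC₂0 : 0 < C₂ := by positivity
  have hCC₁ : C ≤ C₁ := (le_div_self hC.le (by positivity) (pow_le_one₀ hρ.le hρ1)).trans
    (le_div_self (by positivity) hρ hρ1)
  have hC₁₂ : C₁ ≤ C₂ := le_div_self hC₁0.le (by positivity) (pow_le_one₀ hρ.le hρ1)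
  set C₃ := C₂ / ρ / ρ ^ M / ρ with hC₃
  have hC₂₃ : C₂ / ρ ≤ C₃ := (le_div_self (by positivity) (by positivity)
    (pow_le_one₀ hρ.le hρ1)).trans (le_div_self (by positivity) hρ hρ1)
  have hCC₂ : C ≤ C₂ / ρ := (hCC₁.trans hC₁₂).trans (le_div_self (by positivity) hρ hρ1)
  have hgood : ∀ k ∈ F, ∀ s U, 0 < s → Cell k s U → TreeLike M ρ C₁ s U := by
    intro k hk s U hs hU
    obtain ⟨T, hT, hkT⟩ := (hsup k).1 hk
    exact h.treeLike_of_mem_class hM hρ hρ1 hC (h𝒯 T hT).1 hcell (h𝒯 T hT).2 hkT hs hU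
  refine ⟨C₃, by positivity, fun j s U hs hU => ?_⟩
  -- Subcells with types outside `F` are again arbitrary cells; coinduction takes care of them.
  refine TreeLike.coinduction (fun s U => 0 < s ∧ ∃ j, Cell j s U) ?_ ⟨hs, j, hU⟩
  clear hs hU
  rintro s U ⟨hs, j, hU⟩
  obtain ⟨hne, hc, hd⟩ := hcell j s U hs hU
  obtain ⟨S, hSU, hS, hsep⟩ := h j s U hs hU
  have hsub : ∀ x, S x ⊆ U := fun x => hSU ▸ Set.subset_iUnion S x
  let I := {x : Σ k, Fin (B j k) // x.1 ∈ F}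
  let J := {x : Σ k, Fin (B j k) // x.1 ∉ F}
  have hI : Nonempty I := by
    obtain ⟨T, hT, k, hkT, hk⟩ := (hreach j).1
    exact ⟨⟨⟨k, ⟨0, hk⟩⟩, (hsup k).2 ⟨T, hT, hkT⟩⟩⟩
  have hIcard : Fintype.card I ≤ n := by
    calc Fintype.card I ≤ Fintype.card (Σ k, Fin (B j k)) := Fintype.card_subtype_le _
      _ = ∑ k, B j k := by simp
      _ ≤ ∑ k, B j k * v k := Finset.sum_le_sum fun k _ => Nat.le_mul_of_pos_right _ (hv k)
      _ = M * v j := hB j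
      _ ≤ n := Nat.mul_le_mul_left _ (Finset.single_le_sum (f := v) (by simp) (Finset.mem_univ j))
  have hJcard : Fintype.card J < M := by
    refine lt_of_eq_of_lt ?_ (hreach j).2
    rw [Fintype.card_subtype, Finset.card_filter]
    refine (sum_sigma_fin (B j) fun k => if k ∉ F then 1 else 0).trans ?_
    simp only [mul_ite, mul_one, mul_zero]
    rw [← Finset.sum_filter]
    congr 1
    ext k
    simp
  have hHU : (⋃ x : I, S x) ⊆ U := Set.iUnion_subset fun x => hsub x
  have hH : TreeLike M ρ C₂ (ρ * s) (⋃ x : I, S x) := by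
    refine TreeLike.iUnion_fintype hM hρ hρ1 hC₁0 hIcard _
      (fun x => hgood x.1.1 x.2 _ _ (by positivity) (hS x)) ?_ ?_
    · intro x y hxy a ha b hb
      calc ρ * s ≤ s := mul_le_of_le_one_left hs.le hρ1
        _ ≤ C * dist a b := hsep x y (Subtype.coe_ne_coe.2 hxy) a ha b hb
        _ ≤ C₁ * dist a b := by gcongr
    · intro x hx y hy
      exact (hd x (hHU hx) y (hHU hy)).trans (by gcongr)
  -- With the cells of `J` these parts make exactly `M` pieces; at least one part is needed to hold
  -- the cells of `I`.
  obtain ⟨P, hPH, hPsep, hP⟩ := hH.exists_split hM hρ hρ1 hC₂0 (h := M - Fintype.card J)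
    (by omega) (by omega)
  have hPsub : ∀ i, P i ⊆ ⋃ x : I, S x := fun i => hPH ▸ Set.subset_iUnion P i
  have hJP : ∀ (x : J) i, ∀ a ∈ S x, ∀ b ∈ P i, s ≤ C₃ * dist a b := by
    intro x i a ha b hb
    obtain ⟨y, hy⟩ := Set.mem_iUnion.1 (hPsub i hb)
    refine (hsep x y ?_ a ha b hy).trans
      (mul_le_mul_of_nonneg_right (hCC₂.trans hC₂₃) dist_nonneg)
    intro hxy
    exact x.2 (hxy ▸ y.2)
  refine Splits.of_fintype (ι := J ⊕ Fin (M - Fintype.card J)) ?_ hs hne hc ?_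
    (Sum.elim (fun x => S x) P) ?_ ?_ ?_
  · rw [Fintype.card_sum, Fintype.card_fin]
    omega
  · intro x hx y hy
    calc dist x y ≤ C * (ρ * s) := hd x hx y hy
      _ ≤ C * s := by gcongr; exact mul_le_of_le_one_left hs.le hρ1
      _ ≤ C₃ * s := by gcongr; exact hCC₂.trans hC₂₃
  · rw [Set.iUnion_sum]
    simp only [Sum.elim_inl, Sum.elim_inr]
    rw [← hPH, hSU]
    ext a
    simp only [Set.mem_iUnion, Set.mem_union]
    constructor
    · rintro ⟨x, hx⟩
      by_cases hxF : x.1 ∈ F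
      · exact Or.inr ⟨⟨x, hxF⟩, hx⟩
      · exact Or.inl ⟨⟨x, hxF⟩, hx⟩
    · rintro (⟨x, hx⟩ | ⟨x, hx⟩) <;> exact ⟨x, hx⟩
  · rintro (x | i) (y | i') hxy a ha b hb
    · have hne : (x : Σ k, Fin (B j k)) ≠ y := fun h => hxy (by rw [Subtype.ext h])
      exact (hsep x y hne a ha b hb).trans
        (mul_le_mul_of_nonneg_right (hCC₂.trans hC₂₃) dist_nonneg)
    · exact hJP x i' a ha b hb
    · rw [dist_comm]
      exact hJP y i b hb a ha
    · have h1 := hPsep i i' (fun h => hxy (by rw [h])) a ha b hb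
      calc s = ρ * s / ρ := by field_simp
        _ ≤ C₂ * dist a b / ρ := by gcongr
        _ = C₂ / ρ * dist a b := by ring
        _ ≤ C₃ * dist a b := by gcongr
  · rintro (x | i)
    · exact Or.inl ⟨by positivity, _, hS x⟩
    · exact Or.inr (hP i)

end Expansion

/-! ### Cells of a graph-directed system and the conclusion. -/

namespace GraphDirectedSystem

variable {V E X : Type*} [MetricSpace X] {r : ℝ}

/-- `U` is the image of `K j` under a similitude of ratio `s`. -/
def IsCell (K : V → Set X) (j : V) (s : ℝ) (U : Set X) : Prop :=
  ∃ φ : X → X, (∀ x y, dist (φ x) (φ y) = s * dist x y) ∧ U = φ '' K j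

theorem IsCell.isCompact {K : V → Set X} {j : V} {s : ℝ} {U : Set X} (h : IsCell K j s U)
    (hs : 0 ≤ s) (hK : IsCompact (K j)) : IsCompact U := by
  obtain ⟨φ, hφ, rfl⟩ := h
  exact hK.image (LipschitzWith.of_dist_le_mul (K := ⟨s, hs⟩) fun x y => (hφ x y).le).continuous

theorem IsCell.nonempty {K : V → Set X} {j : V} {s : ℝ} {U : Set X} (h : IsCell K j s U)
    (hK : (K j).Nonempty) : U.Nonempty := by
  obtain ⟨φ, -, rfl⟩ := h
  exact hK.image φ

variable [Finite E] {G : GraphDirectedSystem V E X r} {K : V → Set X}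

/-- Disjoint compact sets have positive distance, and there are finitely many pairs of edges. -/
theorem IsDustLike.exists_separation (hdust : G.IsDustLike K) (hK : G.IsGraphDirectedSets K)
    (hr : 0 < r) : ∃ C : ℝ, ∀ e e', G.src e = G.src e' → e ≠ e' →
      ∀ x ∈ G.S e '' K (G.tgt e), ∀ y ∈ G.S e' '' K (G.tgt e'), 1 ≤ C * dist x y := by
  have hc : ∀ e, IsCompact (G.S e '' K (G.tgt e)) := fun e =>
    IsCell.isCompact ⟨G.S e, G.dist_S e, rfl⟩ hr.le (hK.isCompact _)
  have hpair : ∀ p : E × E, ∃ C : ℝ, G.src p.1 = G.src p.2 → p.1 ≠ p.2 →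
      ∀ x ∈ G.S p.1 '' K (G.tgt p.1), ∀ y ∈ G.S p.2 '' K (G.tgt p.2), 1 ≤ C * dist x y := by
    rintro ⟨e, e'⟩
    by_cases h : G.src e = G.src e' ∧ e ≠ e'
    · obtain ⟨δ, hδ, hsep⟩ := Metric.exists_pos_forall_lt_edist (hc e) (hc e').isClosed
        (hdust (G.src e) rfl h.1.symm h.2)
      refine ⟨(δ : ℝ)⁻¹, fun _ _ x hx y hy => ?_⟩
      have h1 := hsep x hx y hy
      rw [edist_nndist, ENNReal.coe_lt_coe] at h1
      have h2 : (δ : ℝ) < dist x y := by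
        rw [← coe_nndist]
        exact_mod_cast h1
      rw [le_inv_mul_iff₀ (by exact_mod_cast hδ), mul_one]
      exact h2.le
    · exact ⟨0, fun h1 h2 => absurd ⟨h1, h2⟩ h⟩
  choose C hC using hpair
  obtain ⟨C', hC'⟩ := (Set.finite_range C).bddAbove
  refine ⟨C', fun e e' h1 h2 x hx y hy => (hC (e, e') h1 h2 x hx y hy).trans ?_⟩
  gcongr
  exact hC' ⟨(e, e'), rfl⟩

/-- A similitude of ratio `s` multiplies all gaps by `s`, so the separation constant of the sets `K
j` serves at every scale. -/
theorem IsDustLike.exists_expands (hdust : G.IsDustLike K)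
    (hK : G.IsGraphDirectedSets K) (hr : 0 < r) :
    ∃ C : ℝ, Expands (IsCell K) G.adjMatrix r C := by
  classical
  obtain ⟨C, hC⟩ := hdust.exists_separation hK hr
  refine ⟨C, ?_⟩
  rintro j s _ hs ⟨φ, hφ, rfl⟩
  have := Fintype.ofFinite E
  obtain ⟨e, he⟩ := exists_equiv_sigma_fin (fun i : {e // G.src e = j} => G.tgt i)
    (fun k => G.adjMatrix j k) (fun k => by
      rw [← Finset.card_filter, ← Fintype.card_subtype, ← Nat.card_eq_fintype_card]
      exact Nat.card_congr (Equiv.subtypeSubtypeEquivSubtypeInter (fun e => G.src e = j)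
        fun e => G.tgt e = k))
  refine ⟨fun x => φ '' (G.S (e x) '' K (G.tgt (e x))), ?_, fun x => ?_, fun x y hxy => ?_⟩
  · rw [e.surjective.iUnion_comp (fun i : {e // G.src e = j} => φ '' (G.S i '' K (G.tgt i))),
      ← Set.image_iUnion, hK.eq_iUnion j]
    congr 1
    ext x
    simp
  · refine ⟨φ ∘ G.S (e x), fun a b => ?_, ?_⟩
    · rw [Function.comp_apply, Function.comp_apply, hφ, G.dist_S]
      ring
    · rw [← he x, Set.image_comp]
  · rintro _ ⟨a, ha, rfl⟩ _ ⟨b, hb, rfl⟩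
    have h1 := hC (e x) (e y) ((e x).2.trans (e y).2.symm)
      (Subtype.coe_ne_coe.2 (e.injective.ne hxy)) a ha b hb
    rw [hφ]
    calc s = s * 1 := (mul_one s).symm
      _ ≤ s * (C * dist a b) := by gcongr
      _ = C * (s * dist a b) := by ring

end GraphDirectedSystem

open GraphDirectedSystem in
theorem theorem1 {p : ℕ} {E : Type*} [Finite E] {X : Type*} [MetricSpace X] [CompactSpace X]
    (r : Set.Ioo (0 : ℝ) 1) (m : ℕ)
    (G : GraphDirectedSystem (Fin p) E X (r : ℝ)) (K : Fin p → Set X)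
    (hK : G.IsGraphDirectedSets K) (hdust : G.IsDustLike K)
    (hm : G.HasIntegerCharacteristic m) :
    ∀ i : Fin p, BilipschitzEquivalent (K i) (SymbolicSpace m r) := by
  intro i
  have hr0 : (0 : ℝ) < r := r.2.1
  obtain ⟨hm2, v, hv, hAv⟩ := hm
  obtain ⟨w, hw, hAw⟩ := G.adjMatrix.exists_nat_eigenvector m v hv fun j => by
    simpa [Matrix.mulVec, dotProduct] using congrFun hAv j
  obtain ⟨L, hL, 𝒯, W, h𝒯, hreach⟩ := G.adjMatrix.exists_pow_equal_weight_rows w hw hm2 hAw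
  let ρ : Set.Ioo (0 : ℝ) 1 :=
    ⟨(r : ℝ) ^ L, pow_pos hr0 L, pow_lt_one₀ hr0.le r.2.2 hL.ne'⟩
  have hρ0 : (0 : ℝ) < ρ := ρ.2.1
  have hM : 2 ≤ m ^ L := hm2.trans (Nat.le_self_pow hL.ne' m)
  obtain ⟨C₀, hC₀⟩ := hdust.exists_expands hK hr0
  obtain ⟨C₁, hC₁⟩ := hC₀.pow hr0 hL
  obtain ⟨D, hD⟩ := Metric.isBounded_iff.1 (isCompact_univ (X := X)).isBounded
  -- `C₁` accounts for separation, `D / ρ` for the diameters measured at scale `ρ * s`, and `1` for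
  -- positivity.
  let C := max (max C₁ (D / ρ)) 1
  have hC : 0 < C := lt_max_of_lt_right one_pos
  have hexp : Expands (IsCell K) (G.adjMatrix ^ L) ρ C :=
    hC₁.mono ((le_max_left _ _).trans (le_max_left _ _))
  obtain ⟨C', hC', htree⟩ := hexp.treeLike hM hρ0 ρ.2.2.le hC
    (fun j s U hs hU => ⟨hU.nonempty (hK.nonempty j), hU.isCompact hs.le (hK.isCompact j), by
      obtain ⟨φ, hφ, rfl⟩ := hU
      rintro _ ⟨x, -, rfl⟩ _ ⟨y, -, rfl⟩
      rw [hφ]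
      calc s * dist x y ≤ s * D := by gcongr; exact hD (Set.mem_univ x) (Set.mem_univ y)
        _ = D / ρ * (ρ * s) := by field_simp
        _ ≤ C * (ρ * s) := by
          gcongr
          exact (le_max_right _ _).trans (le_max_left _ _)⟩)
    hw (Matrix.pow_mul_weight _ w m hAw L) 𝒯 W h𝒯 hreach
  have hKi : IsCell K i 1 (K i) := ⟨id, fun x y => by simp, by simp⟩
  exact ((htree i 1 (K i) one_pos hKi).bilipschitzEquivalent hC').trans
    (SymbolicSpace.bilipschitzEquivalent_pow m L r ρ hL rfl).symm
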